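/- **Lemma 3.1.** Conventions. A digraph $G=(V,E)$ may have parallel edges but no loops; each edge has a tail and a head. $G$ is locally finite (every vertex is incident with only finitely many edges) and weakly connected (its underlying undirected multigraph is connected). Rays are one-way infinite paths in the underlying multigraph, two rays are equivalent if no finite vertex set separates them, and the ends of $G$ are the equivalence classes of rays; $\Omega(G)$ is the set of ends. The closure $\overline X\subseteq V\cup\Omega(G)$ of $X\subseteq V$ consists of $X$ and all ends containing a ray that no finite vertex set separates from $X$. For a bipartition $(X,Y)$ of $V$, $\overrightarrow E(X,Y)$ is the set of edges with tail in $X$ and head in $Y$, and the cut $E(X,Y)$ is $\overrightarrow E(X,Y)\cup\overrightarrow E(Y,X)$; it is a finite cut if it is a finite set of edges. $|G|$ is the Freudenthal compactification of the $1$-complex of the underlying multigraph of $G$; its points are the vertices, the ends and the inner points of edges. For an edge $e$ let $\mathring e\subseteq|G|$ be its set of inner points, linearly ordered by $<_e$ in the direction from the tail to the head of $e$; let $\mathring E=\bigcup_{e\in E}\mathring e$, and for $F\subseteq E$ let $\overline F$ be the closure of $\bigcup_{e\in F}\mathring e$ in $|G|$. A topological walk in $|G|$ is a set $W\subseteq|G|$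 with a linear order $<_W$ on $W\cap\mathring E$ for which there is a witness, that is, a continuous map $\sigma:[0,1]\to|G|$ with image $W$ such that every point of $W\cap\mathring E$ has exactly one preimage under $\sigma$, and $p<_W q$ if and only if $\sigma^{-1}(p)<\sigma^{-1}(q)$. It is directed if $<_W$ and $<_e$ agree on $\mathring e$ for every edge $e$ with $\mathring e\cap W\ne\emptyset$, and it is an $s$–$t$ walk if $\sigma(0)=s$ and $\sigma(1)=t$ for a witness $\sigma$. Statement. Let $G$ be a locally finite weakly connected digraph, let $s,t\in V\cup\Omega(G)$ with $s\neq t$, and let $F\subseteq E$. The following are equivalent: (i) $\overline F$ contains a directed topological $s$–$t$ walk. (ii) $|F\cap\overrightarrow E(X,Y)|\ge 1$ for every finite cut $E(X,Y)$ of $G$ with $s\in\overline X$ and $t\in\overline Y$. (iii) There is a set $W\subseteq F$ such that $|W\cap\overrightarrow E(X,Y)|=|W\cap\overrightarrow E(Y,X)|+1$ for every finite cut $E(X,Y)$ of $G$ with $s\in\overline X$ and $t\in\overline Y$. -/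

import Mathlib

/-- A digraph on the vertex set `V` with edge set `E`; parallel edges are allowed, loops are not. -/
structure MultiDigraph (V : Type*) (E : Type*) where
  tail : E → V
  head : E → V
  loopless : ∀ e, tail e ≠ head e

namespace MultiDigraph

variable {V E : Type*} (G : MultiDigraph V E)

/-- The underlying undirected graph, with parallel edges identified: two vertices are adjacent if
some edge joins them, in whichever direction. -/
def underlying : SimpleGraph V where
  Adj u v := ∃ e, (G.tail e = u ∧ G.head e = v) ∨ (G.tail e = v ∧ G.head e = u)
  symm := ⟨fun _ _ ⟨e, he⟩ => ⟨e, he.symm⟩⟩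
  loopless := ⟨fun _ ⟨e, he⟩ => by
    rcases he with ⟨h1, h2⟩ | ⟨h1, h2⟩ <;> exact G.loopless e (h1.trans h2.symm)⟩

def WeaklyConnected : Prop := G.underlying.Connected

/-- Every vertex is incident with only finitely many edges. -/
def LocallyFinite : Prop := ∀ v, {e | G.tail e = v ∨ G.head e = v}.Finite

/-- `u` and `v` are joined, in the underlying undirected graph, by a walk that avoids `S`;
in other words, they lie in the same component of `G - S`. -/
def JoinedOff (S : Set V) (u v : V) : Prop :=
  ∃ p : G.underlying.Walk u v, ∀ w ∈ p.support, w ∉ S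

/-- `S` separates the vertex sets `A` and `B` in the underlying undirected graph. -/
def Separates (S A B : Set V) : Prop := ∀ a ∈ A, ∀ b ∈ B, ¬ G.JoinedOff S a b

/-- Rays: one-way infinite paths in the underlying undirected multigraph. -/
structure Ray where
  vtx : ℕ → V
  edge : ℕ → E
  vtx_injective : Function.Injective vtx
  joins : ∀ n, (G.tail (edge n) = vtx n ∧ G.head (edge n) = vtx (n + 1)) ∨
    (G.tail (edge n) = vtx (n + 1) ∧ G.head (edge n) = vtx n)

variable {G}

/-- Two rays are equivalent if no finite vertex set separates them. -/
def RayEquiv (R R' : G.Ray) : Prop :=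
  ∀ S : Set V, S.Finite → ¬ G.Separates S (Set.range R.vtx) (Set.range R'.vtx)

theorem JoinedOff.symm {S : Set V} {u v : V} (h : G.JoinedOff S u v) : G.JoinedOff S v u := by
  obtain ⟨p, hp⟩ := h
  exact ⟨p.reverse, fun w hw => hp w (by simpa using hw)⟩

theorem JoinedOff.trans {S : Set V} {u v w : V} (h : G.JoinedOff S u v)
    (h' : G.JoinedOff S v w) : G.JoinedOff S u w := by
  obtain ⟨p, hp⟩ := h
  obtain ⟨q, hq⟩ := h'
  refine ⟨p.append q, fun x hx => ?_⟩
  rcases (SimpleGraph.Walk.mem_support_append_iff _ _).1 hx with hx | hx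
  · exact hp x hx
  · exact hq x hx

theorem JoinedOff.mono {S T : Set V} {u v : V} (hST : S ⊆ T) (h : G.JoinedOff T u v) :
    G.JoinedOff S u v := by
  obtain ⟨p, hp⟩ := h
  exact ⟨p, fun w hw hS => hp w hw (hST hS)⟩

theorem JoinedOff.right_notMem {S : Set V} {u v : V} (h : G.JoinedOff S u v) : v ∉ S := by
  obtain ⟨p, hp⟩ := h
  exact hp v p.end_mem_support

theorem JoinedOff.refl {S : Set V} {u : V} (h : u ∉ S) : G.JoinedOff S u u :=
  ⟨SimpleGraph.Walk.nil, fun w hw => by simp at hw; exact hw ▸ h⟩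

/-- A ray leaves every finite vertex set for good. -/
theorem Ray.exists_tail (R : G.Ray) {S : Set V} (hS : S.Finite) :
    ∃ N, ∀ n, N ≤ n → R.vtx n ∉ S := by
  have hf : (R.vtx ⁻¹' S).Finite := hS.preimage R.vtx_injective.injOn
  obtain ⟨N, hN⟩ := hf.bddAbove
  exact ⟨N + 1, fun n hn hmem => by have := hN hmem; omega⟩

theorem Ray.joinedOff_of_tail (R : G.Ray) {S : Set V} {N : ℕ}
    (hN : ∀ n, N ≤ n → R.vtx n ∉ S) (k : ℕ) : G.JoinedOff S (R.vtx N) (R.vtx (N + k)) := by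
  induction k with
  | zero => exact JoinedOff.refl (hN N le_rfl)
  | succ k ih =>
    have hadj : G.underlying.Adj (R.vtx (N + k)) (R.vtx (N + (k + 1))) :=
      ⟨R.edge (N + k), R.joins (N + k)⟩
    refine ih.trans ⟨hadj.toWalk, fun w hw => ?_⟩
    have hw' : w = R.vtx (N + k) ∨ w = R.vtx (N + (k + 1)) := by
      simpa [SimpleGraph.Adj.toWalk] using hw
    rcases hw' with rfl | rfl
    · exact hN _ (by omega)
    · exact hN _ (by omega)

theorem rayEquiv_equivalence : Equivalence (RayEquiv (G := G)) where
  refl R S hS hsep := by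
    obtain ⟨N, hN⟩ := R.exists_tail hS
    exact hsep _ ⟨N, rfl⟩ _ ⟨N, rfl⟩ (JoinedOff.refl (hN N le_rfl))
  symm h S hS hsep := h S hS fun a ha b hb hab => hsep b hb a ha hab.symm
  trans := by
    intro R R' R'' h h' S hS hsep
    obtain ⟨N, hN⟩ := R'.exists_tail hS
    have hfin : (S ∪ R'.vtx '' Set.Iio N).Finite := hS.union ((Set.finite_Iio N).image _)
    have key : ∀ n, R'.vtx n ∉ S ∪ R'.vtx '' Set.Iio N → G.JoinedOff S (R'.vtx N) (R'.vtx n) := by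
      intro n hn
      have hle : N ≤ n := by
        by_contra hlt
        exact hn (Or.inr ⟨n, not_le.1 hlt, rfl⟩)
      obtain ⟨k, rfl⟩ := Nat.exists_eq_add_of_le hle
      exact R'.joinedOff_of_tail hN k
    refine h _ hfin ?_
    rintro a ha _ ⟨i, rfl⟩ hai
    refine h' _ hfin ?_
    rintro _ ⟨j, rfl⟩ c hc hjc
    have h1 := key i hai.right_notMem
    have h2 := key j hjc.symm.right_notMem
    exact hsep a ha c hc (((hai.mono Set.subset_union_left).trans (h1.symm.trans h2)).trans
      (hjc.mono Set.subset_union_left))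

variable (G)

def raySetoid : Setoid G.Ray := ⟨RayEquiv, rayEquiv_equivalence⟩

/-- The ends of `G`: equivalence classes of rays. -/
def Ends := Quotient G.raySetoid

variable {G}

/-- The end that contains the ray `R`. -/
def Ray.toEnd (R : G.Ray) : G.Ends := Quotient.mk G.raySetoid R

variable (G)

/-- The (combinatorial) closure of a vertex set in the union of vertices and ends: the set itself
together with all ends that contain a ray which no finite vertex set separates from it. -/
def vertexClosure (X : Set V) : Set (V ⊕ G.Ends) :=
  {p | (∃ v ∈ X, p = Sum.inl v) ∨
    ∃ R : G.Ray, p = Sum.inr R.toEnd ∧ ∀ S : Set V, S.Finite → ¬ G.Separates S (Set.range R.vtx) X}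

/-- The edges with tail in `X` and head in `Y`. -/
def dirCut (X Y : Set V) : Set E := {e | G.tail e ∈ X ∧ G.head e ∈ Y}

/-- The edges with one endvertex in `X` and the other in `Y`. -/
def cut (X Y : Set V) : Set E := G.dirCut X Y ∪ G.dirCut Y X

/-- The pairs `(X, Y)` of sides of a finite cut with `s` in the closure of `X` and `t` in the
closure of `Y`. -/
def IsFiniteCutFor (s t : V ⊕ G.Ends) (X Y : Set V) : Prop :=
  IsCompl X Y ∧ (G.cut X Y).Finite ∧ s ∈ G.vertexClosure X ∧ t ∈ G.vertexClosure Y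

/-- The points of `|G|`: vertices, ends, and inner points of edges. The inner points of `e` are
parametrised by the open unit interval, running from the tail of `e` to its head. -/
inductive Point
  | vertex (v : V)
  | atEnd (ω : G.Ends)
  | inner (e : E) (x : Set.Ioo (0 : ℝ) 1)

/-- The component of `G - S` that contains a ray of the end `ω`. -/
def endComponent (S : Set V) (ω : G.Ends) : Set V :=
  {v | ∃ R : G.Ray, R.toEnd = ω ∧ ∀ n, G.JoinedOff S v (R.vtx n)}

/-- The basic neighbourhood of the end `ω` for `S` and `ε`: with `C` the component of `G - S` that
contains a ray of `ω`, it consists of all vertices and inner edge points of `C`, all ends that have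
a ray in `C`, and, for the edges between `C` and the rest of the graph (that is, `S`), the
inner points at distance less than `ε` from the endvertex in `C`. -/
def endNhd (S : Set V) (ω : G.Ends) (ε : ℝ) : Set G.Point
  | .vertex v => v ∈ G.endComponent S ω
  | .atEnd ω' => ∃ R : G.Ray, R.toEnd = ω' ∧ ∀ n, R.vtx n ∈ G.endComponent S ω
  | .inner e x =>
      (G.tail e ∈ G.endComponent S ω ∧ (G.head e ∈ G.endComponent S ω ∨ (x : ℝ) < ε)) ∨
      (G.head e ∈ G.endComponent S ω ∧ (G.tail e ∈ G.endComponent S ω ∨ 1 - ε < (x : ℝ)))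

theorem endNhd_mono {S T : Set V} (hST : S ⊆ T) (ω : G.Ends) {ε δ : ℝ} (hεδ : ε ≤ δ) :
    G.endNhd T ω ε ⊆ G.endNhd S ω δ := by
  have hC : G.endComponent T ω ⊆ G.endComponent S ω :=
    fun v ⟨R, hR, h⟩ => ⟨R, hR, fun n => (h n).mono hST⟩
  rintro (v | ω' | ⟨e, x⟩) h
  · exact hC h
  · obtain ⟨R, hR, hn⟩ := h
    exact ⟨R, hR, fun n => hC (hn n)⟩
  · rcases h with ⟨h1, h2⟩ | ⟨h1, h2⟩
    · exact Or.inl ⟨hC h1, h2.imp (fun h => hC h) fun h => by linarith⟩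
    · exact Or.inr ⟨hC h1, h2.imp (fun h => hC h) fun h => by linarith⟩

/-- The topology of `|G|`, the Freudenthal compactification of the 1-complex of `G`: a set is open
if it meets every edge in an open set, contains with each vertex an initial piece of every incident
edge, and contains with each end one of its basic neighbourhoods. -/
instance : TopologicalSpace G.Point where
  IsOpen U :=
    (∀ e, IsOpen {x : Set.Ioo (0 : ℝ) 1 | Point.inner e x ∈ U}) ∧
    (∀ e, Point.vertex (G.tail e) ∈ U →
      ∃ ε > 0, ∀ x : Set.Ioo (0 : ℝ) 1, (x : ℝ) < ε → Point.inner e x ∈ U) ∧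
    (∀ e, Point.vertex (G.head e) ∈ U →
      ∃ ε > 0, ∀ x : Set.Ioo (0 : ℝ) 1, 1 - ε < (x : ℝ) → Point.inner e x ∈ U) ∧
    (∀ ω, Point.atEnd ω ∈ U → ∃ S : Set V, S.Finite ∧ ∃ ε > 0, G.endNhd S ω ε ⊆ U)
  isOpen_univ := by
    refine ⟨fun e => ?_, fun e _ => ⟨1, one_pos, fun _ _ => trivial⟩,
      fun e _ => ⟨1, one_pos, fun _ _ => trivial⟩,
      fun ω _ => ⟨∅, Set.finite_empty, 1, one_pos, Set.subset_univ _⟩⟩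
    simp
  isOpen_inter := by
    rintro U U' ⟨a, b, c, d⟩ ⟨a', b', c', d'⟩
    refine ⟨fun e => (a e).inter (a' e), fun e h => ?_, fun e h => ?_, fun ω h => ?_⟩
    · obtain ⟨ε, hε, H⟩ := b e h.1
      obtain ⟨ε', hε', H'⟩ := b' e h.2
      exact ⟨min ε ε', lt_min hε hε', fun x hx =>
        ⟨H x (hx.trans_le (min_le_left _ _)), H' x (hx.trans_le (min_le_right _ _))⟩⟩
    · obtain ⟨ε, hε, H⟩ := c e h.1
      obtain ⟨ε', hε', H'⟩ := c' e h.2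
      exact ⟨min ε ε', lt_min hε hε', fun x hx =>
        ⟨H x (by linarith [min_le_left ε ε']), H' x (by linarith [min_le_right ε ε'])⟩⟩
    · obtain ⟨S, hS, ε, hε, H⟩ := d ω h.1
      obtain ⟨S', hS', ε', hε', H'⟩ := d' ω h.2
      exact ⟨S ∪ S', hS.union hS', min ε ε', lt_min hε hε', Set.subset_inter
        ((G.endNhd_mono Set.subset_union_left ω (min_le_left _ _)).trans H)
        ((G.endNhd_mono Set.subset_union_right ω (min_le_right _ _)).trans H')⟩
  isOpen_sUnion := by
    intro 𝒰 h𝒰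
    refine ⟨fun e => ?_, ?_, ?_, ?_⟩
    · have : {x : Set.Ioo (0 : ℝ) 1 | Point.inner e x ∈ ⋃₀ 𝒰} =
          ⋃ U ∈ 𝒰, {x : Set.Ioo (0 : ℝ) 1 | Point.inner e x ∈ U} := by
        ext x; simp
      rw [this]
      exact isOpen_biUnion fun U hU => (h𝒰 U hU).1 e
    · rintro e ⟨U, hU, h⟩
      obtain ⟨ε, hε, H⟩ := (h𝒰 U hU).2.1 e h
      exact ⟨ε, hε, fun x hx => ⟨U, hU, H x hx⟩⟩
    · rintro e ⟨U, hU, h⟩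
      obtain ⟨ε, hε, H⟩ := (h𝒰 U hU).2.2.1 e h
      exact ⟨ε, hε, fun x hx => ⟨U, hU, H x hx⟩⟩
    · rintro ω ⟨U, hU, h⟩
      obtain ⟨S, hS, ε, hε, H⟩ := (h𝒰 U hU).2.2.2 ω h
      exact ⟨S, hS, ε, hε, H.trans (Set.subset_sUnion_of_mem hU)⟩

/-- The point of `|G|` given by a vertex or an end. -/
def toPoint : V ⊕ G.Ends → G.Point
  | .inl v => .vertex v
  | .inr ω => .atEnd ω

/-- The inner points of the edges in `F`. -/
def innerPoints (F : Set E) : Set G.Point := {p | ∃ e ∈ F, ∃ x, p = Point.inner e x}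

/-- The closure in `|G|` of an edge set. -/
def edgeClosure (F : Set E) : Set G.Point := closure (G.innerPoints F)

/-- `σ` is a witness that `(W, lt)` is a topological walk: it is continuous with image `W`, each
inner edge point in `W` has precisely one preimage, and `lt` is the order in which `σ` runs through
the inner edge points in `W`. So `lt` relates only such points, and is a strict linear order on
them. -/
structure IsWitness (W : Set G.Point) (lt : G.Point → G.Point → Prop)
    (σ : unitInterval → G.Point) : Prop where
  continuous : Continuous σ
  range_eq : Set.range σ = W
  existsUnique : ∀ p ∈ G.innerPoints Set.univ ∩ W, ∃! r, σ r = p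
  lt_iff : ∀ p q, lt p q ↔ p ∈ G.innerPoints Set.univ ∩ W ∧ q ∈ G.innerPoints Set.univ ∩ W ∧
    ∃ a b, σ a = p ∧ σ b = q ∧ a < b

/-- Topological walks in `|G|`: a point set together with a linear order on the inner edge points
in it, for which there is a witness. -/
structure TopWalk where
  carrier : Set G.Point
  lt : G.Point → G.Point → Prop
  exists_witness : ∃ σ, G.IsWitness carrier lt σ

/-- The linear order on the inner points of the edge `e` given by the direction of `e`. -/
def edgeLT (e : E) (p q : G.Point) : Prop :=
  ∃ x y : Set.Ioo (0 : ℝ) 1, p = Point.inner e x ∧ q = Point.inner e y ∧ x < y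

variable {G}

/-- A topological walk is directed if, on the inner points of each edge that it uses, its order
equals the order given by the direction of the edge. -/
def TopWalk.IsDirected (W : G.TopWalk) : Prop :=
  ∀ e, (G.innerPoints {e} ∩ W.carrier).Nonempty →
    ∀ p ∈ G.innerPoints {e}, ∀ q ∈ G.innerPoints {e}, (W.lt p q ↔ G.edgeLT e p q)

/-- The topological walk starts in `p` and ends in `q`. -/
def TopWalk.FromTo (W : G.TopWalk) (p q : G.Point) : Prop :=
  ∃ σ, G.IsWitness W.carrier W.lt σ ∧ σ 0 = p ∧ σ 1 = q

end MultiDigraph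

open Filter Topology

namespace MultiDigraph

variable {V E : Type*} {G : MultiDigraph V E}

/-! Everything is expressed through the vertex sets `U` with finite boundary. A vertex or end lies
on exactly one side of each such `U`, distinct points of `V ∪ Ω(G)` are told apart by some `U`, and
every ultrafilter on the vertices converges to such a point (`LocallyFinite.exists_limit`). The
topology of `|G|` is likewise controlled by the functions `level U`, together with `tent e` to tell
parallel edges apart (`LocallyFinite.continuous_of_level_of_tent`).

From (ii), an order on some edges of `F` is built by compactness. Finitely many sets `U` colour the
vertices with finitely many colours, and the quotient has an `F`-trail from the colour of `s` to
that of `t`: otherwise the vertices of reachable colour form the side of a finite cut that no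
`F`-edge leaves. The trail orders its edges, and telescoping the indicator of `U` along it gives
`Tracks`. Each instance of `Tracks` involves only the finitely many edges across one cut, so an
ultrafilter limit of these orders satisfies it for all `U` at once (`exists_order`).

This order gives both other statements. Its edge set serves as `W` in (iii), since the total balance
counts forward minus backward crossings. For (i), the edges are laid out as disjoint intervals with
dense union in the unit interval (`IsOrderWithin.exists_intervalRep`) and traversed linearly. At the
remaining times the position is the limit of the heads of the edges already completed
(`exists_point_of_initial`). Seen through `level U`, the position is a finite sum of continuous
functions, so the walk is continuous.

For (i) ⇒ (ii), `level Y` rises from 0 to 1 along the walk. If `F` had no edge from `X` to `Y`, the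
rise would take place inside an edge from `Y` to `X`, run backwards. Finally, (iii) yields (ii)
because a number of the form `n + 1` is at least 1. -/

/-- The real indicator of a proposition. -/
noncomputable def ind (P : Prop) : ℝ := open Classical in if P then 1 else 0

@[simp] theorem ind_of_true {P : Prop} (h : P) : ind P = 1 := by simp [ind, h]

@[simp] theorem ind_of_false {P : Prop} (h : ¬ P) : ind P = 0 := by simp [ind, h]

theorem ind_congr {P Q : Prop} (h : P ↔ Q) : ind P = ind Q := by rw [propext h]

theorem ind_inj {P Q : Prop} : ind P = ind Q ↔ (P ↔ Q) := by
  by_cases hP : P <;> by_cases hQ : Q <;> simp [hP, hQ]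

/-! ### Vertex sets with finite boundary -/

variable (G)

/-- Only finitely many edges join `U` to its complement. -/
def FiniteBoundary (U : Set V) : Prop := (G.cut U Uᶜ).Finite

/-- The endvertices of the edges that join `U` to its complement. -/
def boundaryVertices (U : Set V) : Set V := G.tail '' G.cut U Uᶜ ∪ G.head '' G.cut U Uᶜ

variable {G}

theorem mem_cut_compl {U : Set V} {e : E} :
    e ∈ G.cut U Uᶜ ↔ ¬ (G.tail e ∈ U ↔ G.head e ∈ U) := by
  simp only [cut, dirCut, Set.mem_union, Set.mem_ofPred_eq, Set.mem_compl_iff]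
  tauto

theorem FiniteBoundary.finite_boundaryVertices {U : Set V} (hU : G.FiniteBoundary U) :
    (G.boundaryVertices U).Finite := (hU.image _).union (hU.image _)

theorem mem_iff_of_tail_notMem {U : Set V} {e : E} (h : G.tail e ∉ G.boundaryVertices U) :
    G.tail e ∈ U ↔ G.head e ∈ U := by
  by_contra hc
  exact h (Or.inl ⟨e, mem_cut_compl.2 hc, rfl⟩)

theorem mem_iff_of_head_notMem {U : Set V} {e : E} (h : G.head e ∉ G.boundaryVertices U) :
    G.tail e ∈ U ↔ G.head e ∈ U := by
  by_contra hc
  exact h (Or.inr ⟨e, mem_cut_compl.2 hc, rfl⟩)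

theorem mem_iff_of_adj {U : Set V} {u v : V} (h : G.underlying.Adj u v)
    (hu : u ∉ G.boundaryVertices U) : u ∈ U ↔ v ∈ U := by
  obtain ⟨e, ⟨rfl, rfl⟩ | ⟨rfl, rfl⟩⟩ := h
  · exact mem_iff_of_tail_notMem hu
  · exact (mem_iff_of_head_notMem hu).symm

/-- A walk can change sides only along a boundary edge, both of whose endvertices are in
`boundaryVertices U`. -/
theorem JoinedOff.mem_iff {U S : Set V} {u v : V} (h : G.JoinedOff S u v)
    (hS : G.boundaryVertices U ⊆ S) : u ∈ U ↔ v ∈ U := by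
  obtain ⟨p, hp⟩ := h
  induction p with
  | nil => rfl
  | cons hadj p ih =>
    refine (mem_iff_of_adj hadj fun h => hp _ (by simp) (hS h)).trans (ih fun w hw => hp w ?_)
    simp [hw]

theorem JoinedOff.of_adj {S : Set V} {u v : V} (h : G.underlying.Adj u v) (hu : u ∉ S)
    (hv : v ∉ S) : G.JoinedOff S u v := by
  refine ⟨h.toWalk, fun w hw => ?_⟩
  have hw' : w = u ∨ w = v := by simpa [SimpleGraph.Adj.toWalk] using hw
  rcases hw' with rfl | rfl <;> assumption

/-- A vertex set that is closed under passing to neighbours outside a finite set has a finite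
boundary. -/
theorem LocallyFinite.finiteBoundary_of_closed (hlf : G.LocallyFinite) {S U : Set V}
    (hS : S.Finite) (h : ∀ u ∈ U, ∀ v, G.underlying.Adj u v → v ∉ S → v ∈ U) :
    G.FiniteBoundary U := by
  refine (hS.biUnion fun v _ => hlf v).subset fun e he => ?_
  simp only [Set.mem_iUnion, Set.mem_ofPred_eq, exists_prop]
  rcases he with ⟨h1, h2⟩ | ⟨h1, h2⟩
  · exact ⟨G.head e, by_contra fun hc => h2 (h _ h1 _ ⟨e, Or.inl ⟨rfl, rfl⟩⟩ hc), Or.inr rfl⟩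
  · exact ⟨G.tail e, by_contra fun hc => h1 (h _ h2 _ ⟨e, Or.inr ⟨rfl, rfl⟩⟩ hc), Or.inl rfl⟩

theorem LocallyFinite.finiteBoundary_singleton (hlf : G.LocallyFinite) (v : V) :
    G.FiniteBoundary {v} := by
  refine (hlf v).subset fun e he => ?_
  rcases he with ⟨h1, -⟩ | ⟨-, h1⟩
  · exact Or.inl h1
  · exact Or.inr h1

theorem LocallyFinite.finiteBoundary_endComponent (hlf : G.LocallyFinite) {S : Set V}
    (hS : S.Finite) (ω : G.Ends) : G.FiniteBoundary (G.endComponent S ω) := by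
  refine hlf.finiteBoundary_of_closed hS ?_
  rintro u ⟨R, hR, hu⟩ v huv hv
  exact ⟨R, hR, fun n => (JoinedOff.of_adj huv.symm hv (hu 0).symm.right_notMem).trans (hu n)⟩

theorem LocallyFinite.finiteBoundary_joinedOff (hlf : G.LocallyFinite) {S : Set V}
    (hS : S.Finite) (u : V) : G.FiniteBoundary {v | G.JoinedOff S u v} := by
  refine hlf.finiteBoundary_of_closed hS ?_
  intro v hv w hvw hw
  exact JoinedOff.trans hv (JoinedOff.of_adj hvw (JoinedOff.right_notMem hv) hw)

theorem FiniteBoundary.compl {U : Set V} (hU : G.FiniteBoundary U) : G.FiniteBoundary Uᶜ := by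
  refine hU.subset fun e he => ?_
  rw [mem_cut_compl] at he ⊢
  simpa [not_iff_not] using he

theorem Ray.exists_forall_mem_iff (R : G.Ray) {U : Set V} (hU : G.FiniteBoundary U) :
    ∃ N, ∀ n, N ≤ n → (R.vtx N ∈ U ↔ R.vtx n ∈ U) := by
  obtain ⟨N, hN⟩ := R.exists_tail hU.finite_boundaryVertices
  refine ⟨N, fun n hn => ?_⟩
  obtain ⟨k, rfl⟩ := Nat.exists_eq_add_of_le hn
  exact (R.joinedOff_of_tail hN k).mem_iff subset_rfl

theorem Ray.eventually_mem_or (R : G.Ray) {U : Set V} (hU : G.FiniteBoundary U) :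
    (∀ᶠ n in atTop, R.vtx n ∈ U) ∨ ∀ᶠ n in atTop, R.vtx n ∉ U := by
  obtain ⟨N, hN⟩ := R.exists_forall_mem_iff hU
  by_cases h : R.vtx N ∈ U
  · exact Or.inl (eventually_atTop.2 ⟨N, fun n hn => (hN n hn).1 h⟩)
  · exact Or.inr (eventually_atTop.2 ⟨N, fun n hn => fun h' => h ((hN n hn).2 h')⟩)

/-- If no finite set separates `R` from `A`, and `A` lies in `U`, then `R` is eventually in `U`. -/
theorem Ray.eventually_mem_of_not_separates (R : G.Ray) {U A : Set V} (hU : G.FiniteBoundary U)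
    (hA : A ⊆ U) (h : ∀ S : Set V, S.Finite → ¬ G.Separates S (Set.range R.vtx) A) :
    ∀ᶠ n in atTop, R.vtx n ∈ U := by
  refine (R.eventually_mem_or hU).resolve_right fun hc => ?_
  obtain ⟨N, hN⟩ := eventually_atTop.1 hc
  -- Deleting the first `N` vertices of `R` as well leaves only vertices outside `U`, and these
  -- cannot reach `A` without meeting the boundary.
  refine h (G.boundaryVertices U ∪ R.vtx '' Set.Iio N)
    (hU.finite_boundaryVertices.union ((Set.finite_Iio N).image _)) ?_
  rintro _ ⟨i, rfl⟩ a ha hia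
  have hi : N ≤ i := by
    by_contra hlt
    exact hia.symm.right_notMem (Or.inr ⟨i, not_le.1 hlt, rfl⟩)
  exact hN i hi ((hia.mem_iff Set.subset_union_left).2 (hA ha))

theorem Ray.eventually_mem_of_rayEquiv {R R' : G.Ray} {U : Set V} (hU : G.FiniteBoundary U)
    (h : RayEquiv R R') (hR' : ∀ᶠ n in atTop, R'.vtx n ∈ U) : ∀ᶠ n in atTop, R.vtx n ∈ U := by
  obtain ⟨N, hN⟩ := eventually_atTop.1 hR'
  refine R.eventually_mem_of_not_separates (A := R'.vtx '' Set.Ici N) hU ?_ fun S hS hsep => ?_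
  · rintro _ ⟨n, hn, rfl⟩
    exact hN n hn
  · refine h (S ∪ R'.vtx '' Set.Iio N) (hS.union ((Set.finite_Iio N).image _)) ?_
    rintro a ha _ ⟨i, rfl⟩ hai
    have hi : N ≤ i := by
      by_contra hlt
      exact hai.right_notMem (Or.inr ⟨i, not_le.1 hlt, rfl⟩)
    exact hsep a ha _ ⟨i, hi, rfl⟩ (hai.mono Set.subset_union_left)

@[simp] theorem inl_mem_vertexClosure {U : Set V} {v : V} :
    Sum.inl v ∈ G.vertexClosure U ↔ v ∈ U := by
  simp [vertexClosure]

/-- For finite boundary, the closure can be tested on any one ray of the end, since equivalent rays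
settle on the same side. -/
theorem toEnd_mem_vertexClosure {U : Set V} (hU : G.FiniteBoundary U) (R : G.Ray) :
    Sum.inr R.toEnd ∈ G.vertexClosure U ↔ ∀ᶠ n in atTop, R.vtx n ∈ U := by
  constructor
  · rintro (⟨v, -, hv⟩ | ⟨R', hR', h⟩)
    · cases hv
    · exact Ray.eventually_mem_of_rayEquiv hU (Quotient.exact (Sum.inr.inj hR'))
        (R'.eventually_mem_of_not_separates hU subset_rfl h)
  · intro h
    refine Or.inr ⟨R, rfl, fun S hS hsep => ?_⟩
    obtain ⟨N, hN⟩ := R.exists_tail hS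
    obtain ⟨n, h1, h2⟩ := (h.and (eventually_ge_atTop N)).exists
    exact hsep _ ⟨n, rfl⟩ _ h1 (JoinedOff.refl (hN n h2))

theorem exists_toEnd_eq (ω : G.Ends) : ∃ R : G.Ray, R.toEnd = ω := Quotient.exists_rep ω

/-- Every vertex or end is the limit of a filter on the vertices, in the sense that the filter
decides on which side of each finite cut the point lies. -/
theorem exists_filter (p : V ⊕ G.Ends) : ∃ N : Filter V, N.NeBot ∧ ∀ U, G.FiniteBoundary U →
    ∀ᶠ v in N, (p ∈ G.vertexClosure U ↔ v ∈ U) := by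
  rcases p with v | ω
  · exact ⟨pure v, inferInstance, fun U _ => by simp⟩
  · obtain ⟨R, rfl⟩ := exists_toEnd_eq ω
    refine ⟨map R.vtx atTop, inferInstance, fun U hU => ?_⟩
    rw [toEnd_mem_vertexClosure hU, eventually_map]
    rcases R.eventually_mem_or hU with h | h
    · filter_upwards [h] with n hn
      simp [h, hn]
    · filter_upwards [h] with n hn
      simp only [hn, iff_false]
      intro hc
      obtain ⟨m, h1, h2⟩ := (h.and hc).exists
      exact h1 h2

/-- Lets a vertex stand in for an end whenever only finitely many cuts are in play. -/
theorem exists_vertex_forall_mem_iff (p : V ⊕ G.Ends) {P : Set (Set V)} (hP : P.Finite)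
    (hb : ∀ U ∈ P, G.FiniteBoundary U) : ∃ v, ∀ U ∈ P, (p ∈ G.vertexClosure U ↔ v ∈ U) := by
  obtain ⟨N, hN, h⟩ := exists_filter p
  exact ((eventually_all_finite hP).2 fun U hU => h U (hb U hU)).exists

theorem mem_vertexClosure_compl {U : Set V} (hU : G.FiniteBoundary U) (p : V ⊕ G.Ends) :
    p ∈ G.vertexClosure Uᶜ ↔ p ∉ G.vertexClosure U := by
  obtain ⟨v, hv⟩ := exists_vertex_forall_mem_iff p (P := {U, Uᶜ}) (by simp)
    (by rintro _ (rfl | rfl); exacts [hU, hU.compl])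
  rw [hv U (by simp), hv Uᶜ (by simp), Set.mem_compl_iff]

theorem LocallyFinite.exists_separating (hlf : G.LocallyFinite) {p q : V ⊕ G.Ends} (hpq : p ≠ q) :
    ∃ U, G.FiniteBoundary U ∧ ¬ (p ∈ G.vertexClosure U ↔ q ∈ G.vertexClosure U) := by
  rcases p with v | ω
  · refine ⟨{v}, hlf.finiteBoundary_singleton v, fun h => ?_⟩
    have hq := h.1 (by simp)
    rcases q with w | ω
    · exact hpq (by simp at hq; rw [hq])
    · obtain ⟨R, rfl⟩ := exists_toEnd_eq ω
      rw [toEnd_mem_vertexClosure (hlf.finiteBoundary_singleton v)] at hq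
      obtain ⟨N, hN⟩ := eventually_atTop.1 hq
      exact absurd (R.vtx_injective ((hN N le_rfl).trans (hN (N + 1) (by omega)).symm)) (by omega)
  rcases q with w | ω'
  · refine ⟨{w}, hlf.finiteBoundary_singleton w, fun h => ?_⟩
    have hq := h.2 (by simp)
    obtain ⟨R, rfl⟩ := exists_toEnd_eq ω
    rw [toEnd_mem_vertexClosure (hlf.finiteBoundary_singleton w)] at hq
    obtain ⟨N, hN⟩ := eventually_atTop.1 hq
    exact absurd (R.vtx_injective ((hN N le_rfl).trans (hN (N + 1) (by omega)).symm)) (by omega)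
  · obtain ⟨R, rfl⟩ := exists_toEnd_eq ω
    obtain ⟨R', rfl⟩ := exists_toEnd_eq ω'
    have hne : ¬ RayEquiv R R' := fun h => hpq (congrArg Sum.inr (Quotient.sound h))
    simp only [RayEquiv, not_forall, not_not] at hne
    obtain ⟨S, hS, hsep⟩ := hne
    obtain ⟨N, hN⟩ := R.exists_tail hS
    -- The component of `G - S` that contains a tail of `R`; `R'` cannot meet it.
    refine ⟨{v | G.JoinedOff S (R.vtx N) v}, hlf.finiteBoundary_joinedOff hS _, fun h => ?_⟩
    rw [toEnd_mem_vertexClosure (hlf.finiteBoundary_joinedOff hS _),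
      toEnd_mem_vertexClosure (hlf.finiteBoundary_joinedOff hS _)] at h
    obtain ⟨n, hn⟩ := (h.1 (eventually_atTop.2 ⟨N, fun n hn => by
      obtain ⟨k, rfl⟩ := Nat.exists_eq_add_of_le hn
      exact R.joinedOff_of_tail hN k⟩)).exists
    exact hsep _ ⟨N, rfl⟩ _ ⟨n, rfl⟩ hn

/-! ### Continuous functions on `|G|` -/

variable (G)

/-- The function on `|G|` that is `1` on the closure of `U`, `0` on the closure of its complement,
and affine on the edges. -/
noncomputable def level (U : Set V) : G.Point → ℝ
  | .vertex v => ind (v ∈ U)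
  | .atEnd ω => ind (Sum.inr ω ∈ G.vertexClosure U)
  | .inner e x => (1 - (x : ℝ)) * ind (G.tail e ∈ U) + x * ind (G.head e ∈ U)

/-- The function on `|G|` that is `x (1 - x)` at the point `x` of `e` and vanishes elsewhere. -/
noncomputable def tent (e : E) : G.Point → ℝ
  | .inner e' x => ind (e' = e) * (x * (1 - x))
  | _ => 0

variable {G}

theorem level_toPoint (U : Set V) (p : V ⊕ G.Ends) :
    G.level U (G.toPoint p) = ind (p ∈ G.vertexClosure U) := by
  rcases p with v | ω
  · exact ind_congr inl_mem_vertexClosure.symm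
  · rfl

theorem level_inner_of_iff {U : Set V} {e : E} (h : G.tail e ∈ U ↔ G.head e ∈ U)
    (x : Set.Ioo (0 : ℝ) 1) : G.level U (.inner e x) = ind (G.tail e ∈ U) := by
  simp only [level, ← ind_congr h]
  ring

@[simp] theorem level_head_inner (e : E) (x : Set.Ioo (0 : ℝ) 1) :
    G.level {G.head e} (.inner e x) = x := by
  simp [level, G.loopless e]

@[simp] theorem level_tail_inner (e : E) (x : Set.Ioo (0 : ℝ) 1) :
    G.level {G.tail e} (.inner e x) = 1 - x := by
  simp [level, (G.loopless e).symm]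

/-- The component of `ω` lies entirely on the side of `ω`. -/
theorem mem_iff_of_mem_endComponent {U S : Set V} (hU : G.FiniteBoundary U)
    (hS : G.boundaryVertices U ⊆ S) {ω : G.Ends} {v : V} (hv : v ∈ G.endComponent S ω) :
    v ∈ U ↔ Sum.inr ω ∈ G.vertexClosure U := by
  obtain ⟨R, rfl, h⟩ := hv
  rw [toEnd_mem_vertexClosure hU]
  constructor
  · exact fun hv => Eventually.of_forall fun n => ((h n).mem_iff hS).1 hv
  · intro he
    obtain ⟨n, hn⟩ := he.exists
    exact ((h n).mem_iff hS).2 hn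

/-- Once the boundary vertices are deleted, no edge with an end in the component of `ω` crosses the
cut, so `level U` is constant there, whatever `ε` is. -/
theorem level_eq_of_mem_endNhd {U : Set V} (hU : G.FiniteBoundary U) {ω : G.Ends} {ε : ℝ}
    {p : G.Point} (hp : p ∈ G.endNhd (G.boundaryVertices U) ω ε) :
    G.level U p = ind (Sum.inr ω ∈ G.vertexClosure U) := by
  have hnot : ∀ v ∈ G.endComponent (G.boundaryVertices U) ω, v ∉ G.boundaryVertices U :=
    fun v ⟨R, _, h⟩ => (h 0).symm.right_notMem
  rcases p with v | ω' | ⟨e, x⟩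
  · exact ind_congr (mem_iff_of_mem_endComponent hU subset_rfl hp)
  · obtain ⟨R, rfl, hn⟩ := hp
    refine ind_congr ?_
    rw [toEnd_mem_vertexClosure hU]
    simp only [fun n => mem_iff_of_mem_endComponent hU subset_rfl (hn n), eventually_const]
  · rcases hp with ⟨h1, -⟩ | ⟨h1, -⟩
    · rw [level_inner_of_iff (mem_iff_of_tail_notMem (hnot _ h1))]
      exact ind_congr (mem_iff_of_mem_endComponent hU subset_rfl h1)
    · have h := mem_iff_of_head_notMem (hnot _ h1)
      rw [level_inner_of_iff h]
      exact ind_congr (h.trans (mem_iff_of_mem_endComponent hU subset_rfl h1))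

theorem continuous_level {U : Set V} (hU : G.FiniteBoundary U) : Continuous (G.level U) := by
  refine continuous_def.2 fun O hO => ⟨fun e => ?_, fun e he => ?_, fun e he => ?_, fun ω hω => ?_⟩
  · refine hO.preimage (f := fun x : Set.Ioo (0 : ℝ) 1 => G.level U (.inner e x)) ?_
    simp only [level]
    fun_prop
  · have hc : Continuous fun x : ℝ => (1 - x) * ind (G.tail e ∈ U) + x * ind (G.head e ∈ U) := by
      fun_prop
    obtain ⟨ε, hε, h⟩ := Metric.mem_nhds_iff.1 ((hO.preimage hc).mem_nhds (x := 0)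
      (by simpa [level] using he))
    refine ⟨ε, hε, fun x hx => h ?_⟩
    simpa [abs_of_pos x.2.1] using hx
  · have hc : Continuous fun x : ℝ => (1 - x) * ind (G.tail e ∈ U) + x * ind (G.head e ∈ U) := by
      fun_prop
    obtain ⟨ε, hε, h⟩ := Metric.mem_nhds_iff.1 ((hO.preimage hc).mem_nhds (x := 1)
      (by simpa [level] using he))
    refine ⟨ε, hε, fun x hx => h ?_⟩
    rw [Metric.mem_ball, Real.dist_eq, abs_sub_lt_iff]
    constructor <;> linarith [x.2.2]
  · refine ⟨_, hU.finite_boundaryVertices, 1, one_pos, fun p hp => ?_⟩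
    rw [Set.mem_preimage, level_eq_of_mem_endNhd hU hp]
    exact hω

theorem LocallyFinite.exists_level_of_vertex_mem (hlf : G.LocallyFinite) {O : Set G.Point}
    (hO : IsOpen O) {v : V} (hv : Point.vertex v ∈ O) :
    ∃ ε > 0, ∀ p, 1 - ε < G.level {v} p → p ∈ O := by
  have key : ∀ e ∈ {e | G.tail e = v ∨ G.head e = v}, ∃ ε > 0,
      ∀ x, 1 - ε < G.level {v} (.inner e x) → Point.inner e x ∈ O := by
    rintro e (rfl | rfl)
    · obtain ⟨ε, hε, h⟩ := hO.2.1 e hv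
      refine ⟨ε, hε, fun x hx => h x ?_⟩
      rw [level_tail_inner] at hx
      linarith
    · obtain ⟨ε, hε, h⟩ := hO.2.2.1 e hv
      refine ⟨ε, hε, fun x hx => h x ?_⟩
      rwa [level_head_inner] at hx
  -- Local finiteness allows one `ε` for all edges at `v`.
  have hev : ∀ᶠ ε in 𝓝[>] (0 : ℝ), ∀ e ∈ {e | G.tail e = v ∨ G.head e = v},
      ∀ x, 1 - ε < G.level {v} (.inner e x) → Point.inner e x ∈ O := by
    refine (eventually_all_finite (hlf v)).2 fun e he => ?_
    obtain ⟨ε, hε, h⟩ := key e he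
    filter_upwards [Ioo_mem_nhdsGT hε] with δ hδ x hx
    exact h x (by linarith [hδ.2])
  obtain ⟨ε, h, hε⟩ := (hev.and (Ioo_mem_nhdsGT (one_pos (α := ℝ)))).exists
  refine ⟨ε, hε.1, fun p hp => ?_⟩
  have hpos : 0 < G.level {v} p := by linarith [hε.2]
  rcases p with w | ω | ⟨e, x⟩
  · by_cases hw : w = v
    · rwa [hw]
    · have : w ∉ ({v} : Set V) := hw
      simp [level, this] at hpos
  · by_cases hω : Sum.inr ω ∈ G.vertexClosure {v}
    · obtain ⟨R, rfl⟩ := exists_toEnd_eq ω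
      rw [toEnd_mem_vertexClosure (hlf.finiteBoundary_singleton v)] at hω
      obtain ⟨N, hN⟩ := eventually_atTop.1 hω
      exact absurd (R.vtx_injective ((hN N le_rfl).trans (hN (N + 1) (by omega)).symm)) (by omega)
    · simp [level, hω] at hpos
  · refine h e ?_ x hp
    by_contra hc
    have hc' : G.tail e ∉ ({v} : Set V) ∧ G.head e ∉ ({v} : Set V) := by simpa using hc
    simp [level, hc'.1, hc'.2] at hpos

theorem LocallyFinite.exists_level_of_atEnd_mem (hlf : G.LocallyFinite) {O : Set G.Point}
    (hO : IsOpen O) {ω : G.Ends} (hω : Point.atEnd ω ∈ O) :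
    ∃ U, G.FiniteBoundary U ∧ Sum.inr ω ∈ G.vertexClosure U ∧
      ∃ ε > 0, ∀ p, 1 - ε < G.level U p → p ∈ O := by
  obtain ⟨S, hS, ε, hε, h⟩ := hO.2.2.2 ω hω
  have hU := hlf.finiteBoundary_endComponent hS ω
  -- The bound 1 makes the level positive, which rules out all points that do not touch the
  -- component.
  refine ⟨_, hU, ?_, min ε 1, lt_min hε one_pos, fun p hp => h ?_⟩
  · obtain ⟨R, rfl⟩ := exists_toEnd_eq ω
    rw [toEnd_mem_vertexClosure hU]
    obtain ⟨N, hN⟩ := R.exists_tail hS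
    -- `endComponent` requires a ray that avoids `S` from its first vertex on, hence the passage to
    -- a tail.
    let R' : G.Ray := ⟨fun n => R.vtx (N + n), fun n => R.edge (N + n),
      fun a b hab => by simpa using R.vtx_injective hab, fun n => R.joins (N + n)⟩
    have hR' : R'.toEnd = R.toEnd := by
      refine Quotient.sound fun T hT hsep => ?_
      obtain ⟨M, hM⟩ := R.exists_tail hT
      exact hsep _ ⟨M, rfl⟩ _ ⟨N + M, rfl⟩ (JoinedOff.refl (hM _ (by omega)))
    refine eventually_atTop.2 ⟨N, fun n hn => ⟨R', hR', fun m => ?_⟩⟩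
    obtain ⟨k, rfl⟩ := Nat.exists_eq_add_of_le hn
    exact (R.joinedOff_of_tail hN k).symm.trans (R.joinedOff_of_tail hN m)
  · have hpos : 0 < G.level (G.endComponent S ω) p := by linarith [min_le_right ε 1]
    rcases p with v | ω' | ⟨e, x⟩
    · by_contra hv
      exact hpos.ne' (ind_of_false hv)
    · by_contra hω'
      refine hpos.ne' (ind_of_false fun hc => hω' ?_)
      obtain ⟨R, rfl⟩ := exists_toEnd_eq ω'
      rw [toEnd_mem_vertexClosure hU] at hc
      obtain ⟨N, hN⟩ := eventually_atTop.1 hc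
      refine ⟨⟨fun n => R.vtx (N + n), fun n => R.edge (N + n),
        fun a b hab => by simpa using R.vtx_injective hab, fun n => R.joins (N + n)⟩, ?_,
        fun n => hN _ (by omega)⟩
      refine Quotient.sound fun T hT hsep => ?_
      obtain ⟨M, hM⟩ := R.exists_tail hT
      exact hsep _ ⟨M, rfl⟩ _ ⟨N + M, rfl⟩ (JoinedOff.refl (hM _ (by omega)))
    · have hm := min_le_left ε 1
      by_cases h1 : G.tail e ∈ G.endComponent S ω <;>
        by_cases h2 : G.head e ∈ G.endComponent S ω
      · exact Or.inl ⟨h1, Or.inl h2⟩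
      · simp only [level, ind_of_true h1, ind_of_false h2] at hp
        exact Or.inl ⟨h1, Or.inr (by linarith)⟩
      · simp only [level, ind_of_false h1, ind_of_true h2] at hp
        exact Or.inr ⟨h2, Or.inr (by linarith)⟩
      · simp [level, h1, h2] at hpos

/-- Positivity of `tent e` singles out `e` among its parallel edges, and `level {G.head e}` is then
the coordinate along `e`. -/
theorem exists_level_of_inner_mem {O : Set G.Point}
    (hO : IsOpen O) {e : E} {x : Set.Ioo (0 : ℝ) 1} (hx : Point.inner e x ∈ O) :
    ∃ ε > 0, ∀ p, 0 < G.tent e p → |G.level {G.head e} p - x| < ε → p ∈ O := by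
  obtain ⟨ε, hε, h⟩ := Metric.isOpen_iff.1 (hO.1 e) x hx
  refine ⟨ε, hε, fun p hp hl => ?_⟩
  rcases p with v | ω | ⟨e', y⟩
  · simp [tent] at hp
  · simp [tent] at hp
  · by_cases he : e' = e
    · subst he
      refine h ?_
      rw [level_head_inner] at hl
      rwa [Metric.mem_ball, Subtype.dist_eq, Real.dist_eq]
    · simp [tent, he] at hp

/-- The topology of `|G|` is coarse enough for the functions `level` and `tent` to detect
continuity of maps into it. -/
theorem LocallyFinite.continuous_of_level_of_tent (hlf : G.LocallyFinite) {T : Type*}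
    [TopologicalSpace T] {σ : T → G.Point}
    (hl : ∀ U, G.FiniteBoundary U → Continuous fun r => G.level U (σ r))
    (ht : ∀ e, Continuous fun r => G.tent e (σ r)) : Continuous σ := by
  refine continuous_def.2 fun O hO => isOpen_iff_mem_nhds.2 fun r hr => ?_
  rcases hp : σ r with v | ω | ⟨e, x⟩
  · obtain ⟨ε, hε, h⟩ := hlf.exists_level_of_vertex_mem hO (v := v) (by rw [← hp]; exact hr)
    have hlt : 1 - ε < G.level {v} (σ r) := by simp [hp, level, hε]
    have := (hl _ (hlf.finiteBoundary_singleton v)).continuousAt.eventually (lt_mem_nhds hlt)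
    filter_upwards [this] with r' hr' using h _ hr'
  · obtain ⟨U, hU, hω, ε, hε, h⟩ := hlf.exists_level_of_atEnd_mem hO (ω := ω)
      (by rw [← hp]; exact hr)
    have hlt : 1 - ε < G.level U (σ r) := by simp [hp, level, hε, hω]
    have := (hl _ hU).continuousAt.eventually (lt_mem_nhds hlt)
    filter_upwards [this] with r' hr' using h _ hr'
  · obtain ⟨ε, hε, h⟩ := exists_level_of_inner_mem hO (e := e) (x := x)
      (by rw [← hp]; exact hr)
    have hlt : 0 < G.tent e (σ r) := by
      simpa [hp, tent] using mul_pos x.2.1 (sub_pos.2 x.2.2)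
    have h1 := (ht e).continuousAt.eventually (lt_mem_nhds hlt)
    have hx : G.level {G.head e} (σ r) = x := by rw [hp, level_head_inner]
    have h2 := (hl _ (hlf.finiteBoundary_singleton (G.head e))).continuousAt (x := r) |>.eventually
      (Metric.ball_mem_nhds _ hε)
    filter_upwards [h1, h2] with r' h1 h2
    refine h _ h1 ?_
    rw [Real.dist_eq, hx] at h2
    exact h2

/-! ### Net flow into a vertex set -/

variable (G)

/-- The increase of the indicator of `U` along `e`. -/
noncomputable def increase (U : Set V) (e : E) : ℝ := ind (G.head e ∈ U) - ind (G.tail e ∈ U)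

/-- The net flow into `U` when the edge `e` carries `φ e`. -/
noncomputable def inflow (U : Set V) (φ : E → ℝ) : ℝ := ∑ᶠ e, φ e * G.increase U e

variable {G}

theorem increase_eq_zero {U : Set V} {e : E} (h : e ∉ G.cut U Uᶜ) : G.increase U e = 0 := by
  rw [mem_cut_compl, not_not] at h
  rw [increase, ind_congr h, sub_self]

theorem inflow_congr {U : Set V} {φ ψ : E → ℝ} (h : ∀ e ∈ G.cut U Uᶜ, φ e = ψ e) :
    G.inflow U φ = G.inflow U ψ := by
  refine finsum_congr fun e => ?_
  by_cases he : e ∈ G.cut U Uᶜ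
  · rw [h e he]
  · simp [increase_eq_zero he]

theorem inflow_eq_sum {U : Set V} (φ : E → ℝ) (K : Finset E)
    (hK : ∀ e, e ∈ G.cut U Uᶜ → φ e ≠ 0 → e ∈ K) :
    G.inflow U φ = ∑ e ∈ K, φ e * G.increase U e := by
  refine finsum_eq_sum_of_support_subset _ fun e he => ?_
  rw [Function.mem_support] at he
  refine hK e ?_ (left_ne_zero_of_mul he)
  by_contra hc
  exact right_ne_zero_of_mul he (increase_eq_zero hc)

theorem FiniteBoundary.inflow_eq_sum {U : Set V} (hU : G.FiniteBoundary U) (φ : E → ℝ) :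
    G.inflow U φ = ∑ e ∈ hU.toFinset, φ e * G.increase U e :=
  MultiDigraph.inflow_eq_sum φ _ fun _ he _ => (Set.Finite.mem_toFinset hU).2 he

theorem inflow_indicator_list (U : Set V) {l : List E} (hl : l.Nodup) {φ : E → ℝ}
    (hφ : ∀ e, φ e = ind (e ∈ l)) : G.inflow U φ = (l.map (G.increase U)).sum := by
  classical
  rw [inflow_eq_sum φ l.toFinset, ← List.sum_toFinset _ hl]
  · refine Finset.sum_congr rfl fun e he => ?_
    rw [hφ, ind_of_true (by simpa using he), one_mul]
  · intro e _ he
    rw [hφ] at he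
    by_contra hc
    exact he (ind_of_false (by simpa using hc))

/-! ### Trails between colour classes -/

variable (G)

/-- The edges in `l` form, in this order, a walk from `a` to `b` in the quotient of `G` by the
colouring `c` of its vertices. -/
def IsTrail {Q : Type*} (c : V → Q) : Q → List E → Q → Prop
  | a, [], b => a = b
  | a, e :: l, b => c (G.tail e) = a ∧ IsTrail c (c (G.head e)) l b

variable {G}

theorem isTrail_append {Q : Type*} {c : V → Q} {l₁ l₂ : List E} {a b : Q} :
    G.IsTrail c a (l₁ ++ l₂) b ↔ ∃ m, G.IsTrail c a l₁ m ∧ G.IsTrail c m l₂ b := by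
  induction l₁ generalizing a with
  | nil => simp [IsTrail]
  | cons e l ih =>
    simp only [List.cons_append, IsTrail, ih]
    exact ⟨fun ⟨h, m, h1, h2⟩ => ⟨m, ⟨h, h1⟩, h2⟩, fun ⟨m, ⟨h, h1⟩, h2⟩ => ⟨h, m, h1, h2⟩⟩

/-- The sum telescopes: consecutive edges meet in one colour class, and `U` is a union of colour
classes. -/
theorem IsTrail.sum_increase {Q : Type*} {c : V → Q} {U : Set V}
    (hU : ∀ v w, c v = c w → (v ∈ U ↔ w ∈ U)) {l : List E} {v w : V}
    (h : G.IsTrail c (c v) l (c w)) :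
    ind (v ∈ U) + (l.map (G.increase U)).sum = ind (w ∈ U) := by
  induction l generalizing v with
  | nil => simpa using ind_congr (hU _ _ h)
  | cons e l ih =>
    rw [List.map_cons, List.sum_cons, ← ih h.2, increase, ind_congr (hU _ _ h.1)]
    ring

/-- A trail that reaches the tail class of `e` yields one that reaches its head class. -/
theorem IsTrail.exists_extend {Q : Type*} {c : V → Q} {F : Set E} {a : Q} {l : List E} {e : E}
    (hl : l.Nodup) (hF : ∀ e ∈ l, e ∈ F) (he : e ∈ F) (h : G.IsTrail c a l (c (G.tail e))) :
    ∃ l' : List E, l'.Nodup ∧ (∀ e ∈ l', e ∈ F) ∧ G.IsTrail c a l' (c (G.head e)) := by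
  by_cases hel : e ∈ l
  -- If `e` is already used, the trail is cut off right after it, so that no edge repeats.
  · obtain ⟨l₁, l₂, rfl⟩ := List.append_of_mem hel
    obtain ⟨m, h1, h2, -⟩ := isTrail_append.1 h
    have hsub : (l₁ ++ [e]).Sublist (l₁ ++ e :: l₂) := by simp
    exact ⟨l₁ ++ [e], hl.sublist hsub, fun f hf => hF f (hsub.subset hf),
      isTrail_append.2 ⟨m, h1, h2, rfl⟩⟩
  · refine ⟨l ++ [e], ?_, ?_, isTrail_append.2 ⟨_, h, rfl, rfl⟩⟩
    · rw [List.nodup_append]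
      refine ⟨hl, by simp, ?_⟩
      rintro f hf g hg rfl
      exact hel (by simpa [List.mem_singleton.1 hg] using hf)
    · intro f hf
      rcases List.mem_append.1 hf with hf | hf
      · exact hF f hf
      · rwa [List.mem_singleton.1 hf]

/-- Given finitely many sets with finite boundary, and an `F`-edge from the side of `s` to the
side of `t` in every finite cut, there is an `F`-trail from `s` to `t` in the quotient of `G`
in which vertices are identified if the given sets do not distinguish them. -/
theorem exists_trail {s t : V ⊕ G.Ends} {F : Set E}
    (hF : ∀ X Y : Set V, G.IsFiniteCutFor s t X Y → (F ∩ G.dirCut X Y).Nonempty)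
    {P : Set (Set V)} (hP : P.Finite) (hb : ∀ U ∈ P, G.FiniteBoundary U) :
    ∃ v w : V, (∀ U ∈ P, (s ∈ G.vertexClosure U ↔ v ∈ U)) ∧
      (∀ U ∈ P, (t ∈ G.vertexClosure U ↔ w ∈ U)) ∧
      ∃ l : List E, l.Nodup ∧ (∀ e ∈ l, e ∈ F) ∧
        G.IsTrail (fun v => {U ∈ P | v ∈ U}) {U ∈ P | v ∈ U} l {U ∈ P | w ∈ U} := by
  set c : V → Set (Set V) := fun v => {U ∈ P | v ∈ U} with hc
  have hcext : ∀ {v w}, (∀ U ∈ P, (v ∈ U ↔ w ∈ U)) → c v = c w := fun {v w} h => by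
    ext U
    simp only [hc, Set.mem_ofPred_eq]
    exact and_congr_right (h U)
  obtain ⟨v, hv⟩ := exists_vertex_forall_mem_iff s hP hb
  obtain ⟨w, hw⟩ := exists_vertex_forall_mem_iff t hP hb
  refine ⟨v, w, hv, hw, ?_⟩
  let X : Set V := {x | ∃ l : List E, l.Nodup ∧ (∀ e ∈ l, e ∈ F) ∧ G.IsTrail c (c v) l (c x)}
  change w ∈ X
  by_contra hwX
  have hXc : ∀ {x y}, c x = c y → (x ∈ X ↔ y ∈ X) := fun {x y} h => by
    simp only [X, Set.mem_ofPred_eq, h]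
  -- `X` is a union of colour classes, so an edge that leaves it also crosses the boundary of some
  -- member of `P`.
  have hXb : G.FiniteBoundary X := by
    refine (hP.biUnion fun U hU => hb U hU).subset fun e he => ?_
    rw [mem_cut_compl] at he
    by_contra hc'
    refine he (hXc (hcext fun U hU => ?_))
    by_contra hn
    exact hc' (Set.mem_biUnion hU (mem_cut_compl.2 hn))
  have hins : ∀ U ∈ insert X P, G.FiniteBoundary U := by
    rintro U (rfl | hU)
    exacts [hXb, hb U hU]
  have hside : ∀ (p : V ⊕ G.Ends) (x : V), (∀ U ∈ P, (p ∈ G.vertexClosure U ↔ x ∈ U)) →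
      (p ∈ G.vertexClosure X ↔ x ∈ X) := by
    intro p x hx
    -- `x` represents `p` only for the sets in `P`. The new vertex `y` also represents it for `X`,
    -- and has the same colour as `x`.
    obtain ⟨y, hy⟩ := exists_vertex_forall_mem_iff p (hP.insert X) hins
    rw [hy X (Set.mem_insert _ _)]
    exact hXc (hcext fun U hU => (hy U (Set.mem_insert_of_mem _ hU)).symm.trans (hx U hU))
  obtain ⟨e, heF, he⟩ := hF X Xᶜ ⟨isCompl_compl, hXb,
    (hside s v hv).2 ⟨[], by simp, by simp, rfl⟩,
    (mem_vertexClosure_compl hXb t).2 fun h => hwX ((hside t w hw).1 h)⟩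
  obtain ⟨⟨l, hl, hlF, htr⟩, he2⟩ := he
  exact he2 (htr.exists_extend hl hlF heF)

/-! ### Orders that come from trails -/

/-- `le` is a linear order on a set of edges in `F`, namely on the set of all `e` with `le e e`. -/
structure IsOrderWithin (F : Set E) (le : E → E → Prop) : Prop where
  refl_left : ∀ {e f}, le e f → le e e
  refl_right : ∀ {e f}, le e f → le f f
  trans : ∀ {e f g}, le e f → le f g → le e g
  antisymm : ∀ {e f}, le e f → le f e → e = f
  total : ∀ {e f}, le e e → le f f → le e f ∨ le f e
  mem : ∀ {e}, le e e → e ∈ F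

variable (G)

/-- As far as `U` and its complement are concerned, the edges in the order `le` form a walk from
`s` to `t`. -/
structure Tracks (s t : V ⊕ G.Ends) (le : E → E → Prop) (U : Set V) : Prop where
  upTo : ∀ g, le g g → ind (s ∈ G.vertexClosure U) + G.inflow U (fun e => ind (le e g)) =
    ind (G.head g ∈ U)
  total : ind (s ∈ G.vertexClosure U) + G.inflow U (fun e => ind (le e e)) =
    ind (t ∈ G.vertexClosure U)

variable {G}

/-- The order is that of position in a trail without repeated edges. The edges up to `g` form a
trail that ends in the head class of `g`, so both balances follow by telescoping. -/
theorem exists_order_of_finite {s t : V ⊕ G.Ends} {F : Set E}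
    (hF : ∀ X Y : Set V, G.IsFiniteCutFor s t X Y → (F ∩ G.dirCut X Y).Nonempty)
    {P : Set (Set V)} (hP : P.Finite) (hb : ∀ U ∈ P, G.FiniteBoundary U) :
    ∃ le : E → E → Prop, IsOrderWithin F le ∧ ∀ U ∈ P, G.Tracks s t le U := by
  classical
  obtain ⟨v, w, hv, hw, l, hl, hlF, htr⟩ := exists_trail hF hP hb
  have hcmem : ∀ U ∈ P, ∀ v w, {U ∈ P | v ∈ U} = {U ∈ P | w ∈ U} → (v ∈ U ↔ w ∈ U) := by
    intro U hU v w h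
    have := Set.ext_iff.1 h U
    simpa [hU] using this
  refine ⟨fun e f => e ∈ l ∧ f ∈ l ∧ l.idxOf e ≤ l.idxOf f, ?_, fun U hU => ⟨fun g hg => ?_, ?_⟩⟩
  · constructor
    · exact fun h => ⟨h.1, h.1, le_rfl⟩
    · exact fun h => ⟨h.2.1, h.2.1, le_rfl⟩
    · exact fun h h' => ⟨h.1, h'.2.1, h.2.2.trans h'.2.2⟩
    · exact fun h h' => (List.idxOf_inj h.1).1 (le_antisymm h.2.2 h'.2.2)
    · exact fun {e f} h h' => (le_total (l.idxOf e) (l.idxOf f)).imp (fun H => ⟨h.1, h'.1, H⟩)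
        fun H => ⟨h'.1, h.1, H⟩
    · exact fun h => hlF _ h.1
  · obtain ⟨l₁, l₂, rfl⟩ := List.append_of_mem hg.1
    obtain ⟨m, h1, h2, -⟩ := isTrail_append.1 htr
    have hg1 : g ∉ l₁ := fun h => (List.nodup_append.1 hl).2.2 g h g (by simp) rfl
    have hidx : (l₁ ++ g :: l₂).idxOf g = l₁.length := by
      rw [List.idxOf_append_of_notMem hg1]; simp
    have hsub : (l₁ ++ [g]).Sublist (l₁ ++ g :: l₂) := by simp
    have htake : (l₁ ++ g :: l₂).take (l₁.length + 1) = l₁ ++ [g] := by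
      simp [List.take_append]
    rw [inflow_indicator_list U (hl.sublist hsub), ind_congr (hv U hU)]
    · exact IsTrail.sum_increase (c := fun v => {U ∈ P | v ∈ U}) (hcmem U hU)
        (isTrail_append.2 ⟨m, h1, h2, rfl⟩)
    · intro e
      refine ind_congr ⟨fun he => ?_, fun he => ?_⟩
      · rw [← htake, List.mem_take_iff_idxOf_lt he.1]
        have := he.2.2
        omega
      · have hel := hsub.subset he
        rw [← htake, List.mem_take_iff_idxOf_lt hel] at he
        exact ⟨hel, hg.1, by omega⟩
  · rw [inflow_indicator_list U hl fun e => ind_congr (by simp), ind_congr (hv U hU),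
      ind_congr (hw U hU)]
    exact htr.sum_increase (hcmem U hU)

/-- A compactness argument: the orders for finite families are merged along an ultrafilter on the
directed set of these families. The order axioms pass to the limit, totality because an ultrafilter
is prime. -/
theorem exists_order {s t : V ⊕ G.Ends} {F : Set E}
    (hF : ∀ X Y : Set V, G.IsFiniteCutFor s t X Y → (F ∩ G.dirCut X Y).Nonempty) :
    ∃ le : E → E → Prop, IsOrderWithin F le ∧ ∀ U, G.FiniteBoundary U → G.Tracks s t le U := by
  choose le hle htr using fun P : Finset {U : Set V // G.FiniteBoundary U} =>
    exists_order_of_finite hF (P := Subtype.val '' (P : Set {U : Set V // G.FiniteBoundary U}))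
      (P.finite_toSet.image _) (by rintro _ ⟨U, -, rfl⟩; exact U.2)
  let 𝒱 : Ultrafilter (Finset {U : Set V // G.FiniteBoundary U}) := Ultrafilter.of atTop
  have hagree : ∀ e f, ∀ᶠ P in (𝒱 : Filter _),
      ((∀ᶠ P in (𝒱 : Filter _), le P e f) ↔ le P e f) := by
    intro e f
    by_cases h : ∀ᶠ P in (𝒱 : Filter _), le P e f
    · filter_upwards [h] with P hP using ⟨fun _ => hP, fun _ => h⟩
    · filter_upwards [Ultrafilter.eventually_not.2 h] with P hP using
        ⟨fun h' => absurd h' h, fun h' => absurd h' hP⟩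
  refine ⟨fun e f => ∀ᶠ P in (𝒱 : Filter _), le P e f, ⟨?_, ?_, ?_, ?_, ?_, ?_⟩, fun U hU => ?_⟩
  · exact fun h => h.mono fun P => (hle P).refl_left
  · exact fun h => h.mono fun P => (hle P).refl_right
  · exact fun h h' => by filter_upwards [h, h'] with P h h' using (hle P).trans h h'
  · intro e f h h'
    obtain ⟨P, hP, hP'⟩ := (h.and h').exists
    exact (hle P).antisymm hP hP'
  · intro e f h h'
    refine Ultrafilter.eventually_or.1 ?_
    filter_upwards [h, h'] with P h h' using (hle P).total h h'
  · intro e h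
    obtain ⟨P, hP⟩ := h.exists
    exact (hle P).mem hP
  · have hUP : ∀ᶠ P in (𝒱 : Filter _), G.Tracks s t (le P) U := by
      filter_upwards [Ultrafilter.of_le (f := atTop) (eventually_ge_atTop {⟨U, hU⟩})] with P hP
      exact htr P U ⟨⟨U, hU⟩, hP (by simp), rfl⟩
    refine ⟨fun g hg => ?_, ?_⟩
    -- The balance at `g` sees only the finitely many edges across `U`, so some `P` tracks `U` and
    -- agrees with the limit on all of them.
    · obtain ⟨P, h1, h2, h3⟩ := (hUP.and (hg.and ((eventually_all_finite hU).2
        fun e _ => hagree e g))).exists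
      rw [← h1.upTo g h2, inflow_congr fun e he => ind_congr (h3 e he)]
    · obtain ⟨P, h1, h3⟩ := (hUP.and ((eventually_all_finite hU).2
        fun e _ => hagree e e)).exists
      rw [← h1.total, inflow_congr fun e he => ind_congr (h3 e he)]

/-! ### Representing an order by intervals -/

/-- The linear order `le` on a set of edges is represented by disjoint open subintervals of the
unit interval, with dense union: `e` is represented by the interval from `a e` to `b e`. -/
structure IsIntervalRep (le : E → E → Prop) (a b : E → ℝ) : Prop where
  nonneg : ∀ {e}, le e e → 0 ≤ a e
  lt : ∀ {e}, le e e → a e < b e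
  le_one : ∀ {e}, le e e → b e ≤ 1
  le_of_ne : ∀ {e f}, le e f → e ≠ f → b e ≤ a f
  dense : ∀ c d, 0 ≤ c → c < d → d ≤ 1 → ∃ e x, le e e ∧ c < x ∧ x < d ∧ a e < x ∧ x < b e

theorem exists_weights [Countable E] {W : Set E} (hW : W.Nonempty) :
    ∃ w : E → ℝ, (∀ e, 0 ≤ w e) ∧ (∀ e ∈ W, 0 < w e) ∧ (∀ e ∉ W, w e = 0) ∧ HasSum w 1 := by
  obtain ⟨w, hw, c, hc, -⟩ := W.to_countable.exists_pos_hasSum_le one_pos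
  have hc0 : 0 < c := by
    obtain ⟨e, he⟩ := hW
    exact (hw e).trans_le (le_hasSum hc ⟨e, he⟩ fun i _ => (hw i).le)
  refine ⟨W.indicator fun e => w e / c, fun e => ?_, fun e he => ?_, fun e he => ?_, ?_⟩
  · exact Set.indicator_nonneg (fun e _ => (div_pos (hw e) hc0).le) e
  · rw [Set.indicator_of_mem he]
    exact div_pos (hw e) hc0
  · exact Set.indicator_of_notMem he _
  · refine (hasSum_subtype_iff_indicator (f := fun e => w e / c)).1 ?_
    have := hc.div_const c
    rwa [div_self hc0.ne'] at this

/-- Each edge gets positive weight, with total weight 1, and its interval begins at the total weight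
of the edges before it. Density holds because a missed interval would leave too little room for the
total weight. -/
theorem IsOrderWithin.exists_intervalRep [Countable E] {F : Set E} {le : E → E → Prop}
    (h : IsOrderWithin F le) (hne : ∃ e, le e e) : ∃ a b : E → ℝ, IsIntervalRep le a b := by
  obtain ⟨w, hw0, hwpos, hwz, hw⟩ := exists_weights (W := {e | le e e}) hne
  let m : Set E → ℝ := fun A => ∑' e, A.indicator w e
  have hs : ∀ A : Set E, Summable (A.indicator w) := fun A => hw.summable.indicator A
  have hmono : ∀ {A B : Set E}, A ⊆ B → m A ≤ m B := fun {A B} hAB =>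
    (hs A).tsum_le_tsum (fun e => Set.indicator_le_indicator_of_subset hAB hw0 e) (hs B)
  have hunion : ∀ {A B : Set E}, Disjoint A B → m (A ∪ B) = m A + m B := fun {A B} hAB => by
    simp only [m, Set.indicator_union_of_disjoint hAB]
    exact (hs A).tsum_add (hs B)
  have hone : m Set.univ = 1 := by simp only [m, Set.indicator_univ]; exact hw.tsum_eq
  have hnonneg : ∀ A, 0 ≤ m A := fun A =>
    tsum_nonneg fun e => Set.indicator_nonneg (fun e _ => hw0 e) e
  have hle1 : ∀ A, m A ≤ 1 := fun A => hone ▸ hmono (Set.subset_univ A)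
  have hsingle : ∀ e, m {e} = w e := fun e => by
    simp only [m]
    rw [tsum_eq_single e (fun f hf => by simp [hf])]
    simp
  have hfin : ∀ (s : Finset E) (A B : Set E), (∀ e ∈ s, e ∈ A → e ∈ B) →
      ∑ e ∈ s, A.indicator w e ≤ m B := by
    intro s A B hAB
    refine (Finset.sum_le_sum fun e he => ?_).trans
      ((hs B).sum_le_tsum s fun e _ => Set.indicator_nonneg (fun e _ => hw0 e) e)
    by_cases heA : e ∈ A
    · simp [heA, hAB e he heA]
    · rw [Set.indicator_of_notMem heA]
      exact Set.indicator_nonneg (fun e _ => hw0 e) e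
  let a : E → ℝ := fun e => m {f | le f e ∧ f ≠ e}
  let b : E → ℝ := fun e => m {f | le f e}
  have hab : ∀ {e}, le e e → b e = a e + w e := fun {e} he => by
    rw [← hsingle, ← hunion (by simp)]
    refine congrArg m (Set.ext fun f => ?_)
    simp only [Set.mem_ofPred_eq, Set.mem_union, Set.mem_singleton_iff]
    refine ⟨fun hf => or_iff_not_imp_right.2 fun hne => ⟨hf, hne⟩, ?_⟩
    rintro (hf | rfl)
    exacts [hf.1, he]
  have hlt : ∀ {e}, le e e → a e < b e := fun {e} he => by
    linarith [hab he, hwpos e he]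
  have hne' : ∀ {e f}, le e f → e ≠ f → b e ≤ a f := fun {e f} hef hne => by
    refine hmono fun g hg => ⟨h.trans hg hef, ?_⟩
    rintro rfl
    exact hne (h.antisymm hef hg)
  have hcomp : ∀ {e f}, le e e → le f f → b e ≤ b f → le e f := fun {e f} he hf hb => by
    rcases h.total he hf with h1 | h1
    · exact h1
    · by_cases hef : f = e
      · rwa [hef] at hf ⊢
      · linarith [hne' h1 hef, hlt he]
  refine ⟨a, b, fun _ => hnonneg _, hlt, fun _ => hle1 _, hne', fun c d hc hcd hd => ?_⟩
  by_contra hcon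
  -- If no interval meets `(c, d)`, each edge ends by `c` or starts no earlier than `d`; these edges
  -- weigh at most `c + (1 - d) < 1`.
  have hdich : ∀ e, le e e → b e ≤ c ∨ d ≤ a e := fun e he => by
    by_contra hx
    push Not at hx
    obtain ⟨x, hx1, hx2⟩ := exists_between (max_lt (lt_min hcd hx.1) (lt_min hx.2 (hlt he)))
    rw [max_lt_iff] at hx1
    rw [lt_min_iff] at hx2
    exact hcon ⟨e, x, he, hx1.1, hx2.1, hx1.2, hx2.2⟩
  -- An infinite set of edges need not have a last one. Each finite partial sum does, and is bounded
  -- by the right endpoint of its last edge.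
  have h1 : m {e | le e e ∧ b e ≤ c} ≤ c := by
    refine Real.tsum_le_of_sum_le (fun e => Set.indicator_nonneg (fun e _ => hw0 e) e) fun s => ?_
    classical
    rcases (s.filter fun e => le e e ∧ b e ≤ c).eq_empty_or_nonempty with hs | hs
    · refine (Finset.sum_nonpos fun e he => ?_).trans hc
      refine (Set.indicator_of_notMem (fun hx => ?_) _).le
      have : e ∈ s.filter fun e => le e e ∧ b e ≤ c := Finset.mem_filter.2 ⟨he, hx⟩
      simp [hs] at this
    · obtain ⟨g, hg, hmax⟩ := Finset.exists_max_image _ b hs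
      have hg' := (Finset.mem_filter.1 hg).2
      exact (hfin s _ {f | le f g} fun e he hx =>
        hcomp hx.1 hg'.1 (hmax e (Finset.mem_filter.2 ⟨he, hx⟩))).trans hg'.2
  have h2 : m {e | le e e ∧ d ≤ a e} ≤ 1 - d := by
    refine Real.tsum_le_of_sum_le (fun e => Set.indicator_nonneg (fun e _ => hw0 e) e) fun s => ?_
    classical
    rcases (s.filter fun e => le e e ∧ d ≤ a e).eq_empty_or_nonempty with hs | hs
    · refine (Finset.sum_nonpos fun e he => ?_).trans (sub_nonneg.2 hd)
      refine (Set.indicator_of_notMem (fun hx => ?_) _).le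
      have : e ∈ s.filter fun e => le e e ∧ d ≤ a e := Finset.mem_filter.2 ⟨he, hx⟩
      simp [hs] at this
    · obtain ⟨g, hg, hmin⟩ := Finset.exists_min_image _ b hs
      have hg' := (Finset.mem_filter.1 hg).2
      have h3 := hfin s {e | le e e ∧ d ≤ a e} {f | le g f} fun e he hx =>
        hcomp hg'.1 hx.1 (hmin e (Finset.mem_filter.2 ⟨he, hx⟩))
      -- The edges strictly before `g` and those from `g` on are disjoint.
      have h4 : a g + m {f | le g f} ≤ 1 := by
        rw [← hunion]
        · exact hle1 _
        · refine Set.disjoint_left.2 fun f hf hf' => hf.2 (h.antisymm hf.1 hf')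
      linarith [hg'.2]
  have h3 : m Set.univ ≤ m ({e | le e e ∧ b e ≤ c} ∪ {e | le e e ∧ d ≤ a e}) := by
    refine (hs _).tsum_le_tsum (fun e => ?_) (hs _)
    by_cases he : le e e
    · have : e ∈ {e | le e e ∧ b e ≤ c} ∪ {e | le e e ∧ d ≤ a e} :=
        (hdich e he).imp (fun h => ⟨he, h⟩) fun h => ⟨he, h⟩
      rw [Set.indicator_of_mem this, Set.indicator_univ]
    · rw [Set.indicator_univ, hwz e he]
      exact Set.indicator_nonneg (fun e _ => hw0 e) e
  rw [hunion (Set.disjoint_left.2 fun e h1 h2 => by linarith [h1.2, h2.2, hlt h1.1]), hone] at h3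
  linarith

/-! ### Countability -/

theorem LocallyFinite.finite_adj (hlf : G.LocallyFinite) (v : V) :
    {w | G.underlying.Adj v w}.Finite := by
  refine (((hlf v).image G.tail).union ((hlf v).image G.head)).subset ?_
  rintro w ⟨e, ⟨h1, h2⟩ | ⟨h1, h2⟩⟩
  · exact Or.inr ⟨e, Or.inl h1, h2⟩
  · exact Or.inl ⟨e, Or.inr h2, h1⟩

theorem LocallyFinite.countable_vertices (hlf : G.LocallyFinite) (hconn : G.WeaklyConnected) :
    Countable V := by
  obtain ⟨o⟩ := hconn.nonempty
  let B : ℕ → Set V := fun n => Nat.rec {o} (fun _ S => ⋃ v ∈ S, {w | G.underlying.Adj v w}) n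
  have hB : ∀ n, (B n).Finite := fun n => by
    induction n with
    | zero => exact Set.finite_singleton o
    | succ n ih => exact ih.biUnion fun v _ => hlf.finite_adj v
  have hwalk : ∀ {u v : V} (p : G.underlying.Walk u v) (n : ℕ), u ∈ B n → ∃ m, v ∈ B m := by
    intro u v p
    induction p with
    | nil => exact fun n hn => ⟨n, hn⟩
    | cons hadj p ih => exact fun n hn => ih (n + 1) (Set.mem_biUnion hn hadj)
  have hcount : (⋃ n, B n).Countable := Set.countable_iUnion fun n => (hB n).countable
  have huniv : (⋃ n, B n) = Set.univ := by
    refine Set.eq_univ_of_forall fun v => ?_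
    obtain ⟨p⟩ := hconn.preconnected o v
    exact Set.mem_iUnion.2 (hwalk p 0 rfl)
  rw [huniv] at hcount
  exact Set.countable_univ_iff.1 hcount

theorem LocallyFinite.countable_edges (hlf : G.LocallyFinite) (hconn : G.WeaklyConnected) :
    Countable E := by
  have := hlf.countable_vertices hconn
  have hcount : (⋃ v, {e | G.tail e = v ∨ G.head e = v}).Countable :=
    Set.countable_iUnion fun v => (hlf v).countable
  refine Set.countable_univ_iff.1 (hcount.mono fun e _ => ?_)
  exact Set.mem_iUnion.2 ⟨G.tail e, Or.inl rfl⟩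

/-! ### Convergence of ultrafilters -/

variable (G)

/-- The vertices `w` such that some shortest path from `o` to `w` runs through `v`. -/
def descendants (o v : V) : Set V :=
  {w | G.underlying.dist o v + G.underlying.dist v w = G.underlying.dist o w}

variable {G}

theorem WeaklyConnected.exists_child (hconn : G.WeaklyConnected) {o v w : V}
    (hw : w ∈ G.descendants o v) (hne : v ≠ w) :
    ∃ c, G.underlying.Adj v c ∧ G.underlying.dist o c = G.underlying.dist o v + 1 ∧
      G.underlying.dist v w = G.underlying.dist c w + 1 ∧ w ∈ G.descendants o c := by
  obtain ⟨p, hp⟩ := hconn.exists_walk_length_eq_dist v w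
  cases p with
  | nil => exact absurd rfl hne
  | @cons _ c _ hadj p =>
    have h1 := SimpleGraph.dist_le p
    have h2 : G.underlying.dist v c = 1 := SimpleGraph.dist_eq_one_iff_adj.2 hadj
    have h3 := hconn.dist_triangle (u := v) (v := c) (w := w)
    have h4 := hconn.dist_triangle (u := o) (v := c) (w := w)
    have h5 := hconn.dist_triangle (u := o) (v := v) (w := c)
    rw [SimpleGraph.Walk.length_cons] at hp
    simp only [descendants, Set.mem_ofPred_eq] at hw ⊢
    exact ⟨c, hadj, by omega, by omega, by omega⟩

/-- A shortest path from `v` to a descendant moves away from `o` at every step, so beyond distance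
`N` it never meets the boundary. -/
theorem WeaklyConnected.mem_iff_of_mem_descendants (hconn : G.WeaklyConnected) {o : V} {U : Set V}
    {N : ℕ} (hN : ∀ v ∈ G.boundaryVertices U, G.underlying.dist o v < N) {v w : V}
    (hv : N ≤ G.underlying.dist o v) (hw : w ∈ G.descendants o v) : v ∈ U ↔ w ∈ U := by
  induction hk : G.underlying.dist v w generalizing v with
  | zero => rw [hconn.dist_eq_zero_iff.1 hk]
  | succ k ih =>
    have hne : v ≠ w := by
      rintro rfl
      simp at hk
    obtain ⟨c, hadj, h1, h2, h3⟩ := hconn.exists_child hw hne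
    have hv' : v ∉ G.boundaryVertices U := fun h => absurd (hN v h) (by omega)
    exact (mem_iff_of_adj hadj hv').trans (ih (by omega) h3 (by omega))

/-- `V ∪ Ω(G)` is the Stone space of the Boolean algebra of vertex sets with finite boundary:
every ultrafilter on the vertices converges to a vertex or an end. -/
theorem LocallyFinite.exists_limit (hlf : G.LocallyFinite) (hconn : G.WeaklyConnected)
    (𝒰 : Ultrafilter V) :
    ∃ p : V ⊕ G.Ends, ∀ U, G.FiniteBoundary U → (p ∈ G.vertexClosure U ↔ U ∈ 𝒰) := by
  by_cases hpr : ∃ v, {v} ∈ 𝒰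
  · obtain ⟨v, hv⟩ := hpr
    refine ⟨Sum.inl v, fun U _ => ?_⟩
    rw [inl_mem_vertexClosure]
    refine ⟨fun h => mem_of_superset hv (by simpa using h), fun h => ?_⟩
    obtain ⟨x, hx, rfl⟩ := 𝒰.nonempty_of_mem (inter_mem h hv)
    exact hx
  push Not at hpr
  obtain ⟨o⟩ := hconn.nonempty
  -- As in König's lemma: apart from `v` itself, the descendants of `v` are covered by those of
  -- finitely many children, and the non-principal `𝒰` contains the descendant set of one of them.
  have hstep : ∀ x : {v // G.descendants o v ∈ 𝒰}, ∃ y : {v // G.descendants o v ∈ 𝒰},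
      G.underlying.Adj x y ∧ G.underlying.dist o y = G.underlying.dist o x + 1 := by
    rintro ⟨v, hv⟩
    have hfin : {c | G.underlying.Adj v c ∧
        G.underlying.dist o c = G.underlying.dist o v + 1}.Finite :=
      (hlf.finite_adj v).subset fun c hc => hc.1
    have hmem : (⋃ c ∈ {c | G.underlying.Adj v c ∧
        G.underlying.dist o c = G.underlying.dist o v + 1}, G.descendants o c) ∈ 𝒰 := by
      filter_upwards [hv, Ultrafilter.compl_mem_iff_notMem.2 (hpr v)] with w hw hne
      obtain ⟨c, h1, h2, -, h3⟩ := hconn.exists_child hw fun h => hne h.symm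
      exact Set.mem_biUnion (show c ∈ {c | _} from ⟨h1, h2⟩) h3
    obtain ⟨c, hc, hcU⟩ := (Ultrafilter.finite_biUnion_mem_iff hfin).1 hmem
    exact ⟨⟨c, hcU⟩, hc.1, hc.2⟩
  choose next hadj hdist using hstep
  let x₀ : {v // G.descendants o v ∈ 𝒰} := ⟨o, by
    have : G.descendants o o = Set.univ := Set.eq_univ_of_forall fun w => by simp [descendants]
    rw [this]
    exact univ_mem⟩
  let x : ℕ → {v // G.descendants o v ∈ 𝒰} := fun n => next^[n] x₀
  have hx : ∀ n, x (n + 1) = next (x n) := fun n => Function.iterate_succ_apply' next n x₀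
  have hd : ∀ n, G.underlying.dist o (x n) = n := fun n => by
    induction n with
    | zero => simp [x, x₀]
    | succ n ih => rw [hx, hdist, ih]
  have hjoin : ∀ n, ∃ e, (G.tail e = x n ∧ G.head e = x (n + 1)) ∨
      (G.tail e = x (n + 1) ∧ G.head e = x n) := fun n => by
    rw [hx]
    exact hadj (x n)
  choose edge hedge using hjoin
  let R : G.Ray := ⟨fun n => x n, edge, fun m n h => by
    rw [← hd m, ← hd n]
    exact congrArg _ h, hedge⟩
  have key : ∀ U, G.FiniteBoundary U → U ∈ 𝒰 → ∀ᶠ n in atTop, R.vtx n ∈ U := by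
    intro U hU hmem
    obtain ⟨N, hN⟩ := (hU.finite_boundaryVertices.image fun v => G.underlying.dist o v).bddAbove
    refine eventually_atTop.2 ⟨N + 1, fun n hn => ?_⟩
    -- One descendant of `x n` in `U` is enough, as far out they all lie on the same side as `x n`.
    obtain ⟨w, hw, hwU⟩ := 𝒰.nonempty_of_mem (inter_mem (x n).2 hmem)
    exact (hconn.mem_iff_of_mem_descendants (N := N + 1)
      (fun v hv => Nat.lt_succ_of_le (hN ⟨v, hv, rfl⟩)) (by rw [hd]; exact hn) hw).2 hwU
  refine ⟨Sum.inr R.toEnd, fun U hU => ?_⟩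
  rw [toEnd_mem_vertexClosure hU]
  refine ⟨fun h => ?_, key U hU⟩
  by_contra hc
  obtain ⟨n, h1, h2⟩ := (h.and (key Uᶜ hU.compl (Ultrafilter.compl_mem_iff_notMem.2 hc))).exists
  exact h2 h1

theorem inflow_sub_single {U : Set V} (hU : G.FiniteBoundary U) (φ : E → ℝ) (e : E) (y : ℝ) :
    G.inflow U (fun f => φ f - ind (f = e) * y) = G.inflow U φ - y * G.increase U e := by
  classical
  have hK : ∀ ψ : E → ℝ, G.inflow U ψ =
      ∑ f ∈ insert e (Set.Finite.toFinset hU), ψ f * G.increase U f := fun ψ =>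
    inflow_eq_sum ψ _ fun f hf _ => Finset.mem_insert_of_mem ((Set.Finite.mem_toFinset hU).2 hf)
  simp only [hK, sub_mul, Finset.sum_sub_distrib]
  congr 1
  rw [Finset.sum_eq_single e]
  · simp
  · intro f _ hf
    simp [hf]
  · simp

/-- Every initial segment `D` of the edges in a walk order ends in a vertex or an end. -/
theorem exists_point_of_initial (hlf : G.LocallyFinite) (hconn : G.WeaklyConnected)
    {s t : V ⊕ G.Ends} {F : Set E} {le : E → E → Prop} (h : IsOrderWithin F le)
    (htr : ∀ U, G.FiniteBoundary U → G.Tracks s t le U) {D : Set E} (hD : ∀ e ∈ D, le e e)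
    (hinit : ∀ e f, le e f → f ∈ D → e ∈ D) :
    ∃ p : V ⊕ G.Ends, ∀ U, G.FiniteBoundary U →
      ind (p ∈ G.vertexClosure U) = ind (s ∈ G.vertexClosure U) +
        G.inflow U fun e => ind (e ∈ D) := by
  rcases D.eq_empty_or_nonempty with rfl | hne
  · exact ⟨s, fun U _ => by simp [inflow]⟩
  let _ : Preorder D :=
    { le := fun x y => le x y
      le_refl := fun x => hD x x.2
      le_trans := fun _ _ _ => h.trans }
  have : IsDirectedOrder D := ⟨fun x y => by
    rcases h.total (hD x x.2) (hD y y.2) with hxy | hxy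
    · exact ⟨y, hxy, hD y y.2⟩
    · exact ⟨x, hD x x.2, hxy⟩⟩
  have : Nonempty D := hne.to_subtype
  -- The point is a limit of heads towards the upper end of `D`, which need not have a last edge.
  -- Past the finitely many edges of `D` across `U`, the balance up to `g` is that of all of `D`.
  let 𝒰 : Ultrafilter D := Ultrafilter.of atTop
  obtain ⟨p, hp⟩ := hlf.exists_limit hconn (𝒰.map fun x => G.head x)
  refine ⟨p, fun U hU => ?_⟩
  have hev : ∀ᶠ g : D in (𝒰 : Filter D), ind (G.head g ∈ U) = ind (s ∈ G.vertexClosure U) +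
      G.inflow U fun e => ind (e ∈ D) := by
    have hlarge : ∀ e ∈ G.cut U Uᶜ, ∀ᶠ g : D in (𝒰 : Filter D), e ∈ D → le e g := by
      intro e _
      by_cases he : e ∈ D
      · filter_upwards [Ultrafilter.of_le atTop (eventually_ge_atTop (⟨e, he⟩ : D))] with g hg _
          using hg
      · exact Eventually.of_forall fun g h => absurd h he
    filter_upwards [(eventually_all_finite hU).2 hlarge] with g hg
    rw [← (htr U hU).upTo g (hD g g.2), inflow_congr fun e he =>
      ind_congr ⟨fun h => hinit e g h g.2, hg e he⟩]
  by_cases hpU : p ∈ G.vertexClosure U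
  · have hmem : ∀ᶠ g : D in (𝒰 : Filter D), G.head g ∈ U := (hp U hU).1 hpU
    obtain ⟨g, h1, h2⟩ := (hev.and hmem).exists
    rw [← h1, ind_of_true hpU, ind_of_true h2]
  · have hmem : ∀ᶠ g : D in (𝒰 : Filter D), G.head g ∉ U :=
      Ultrafilter.eventually_not.2 fun h => hpU ((hp U hU).2 h)
    obtain ⟨g, h1, h2⟩ := (hev.and hmem).exists
    rw [← h1, ind_of_false hpU, ind_of_false h2]

/-! ### Running through the edges in order -/

/-- How much of the edge `e` has been traversed at time `r`, if `e` is traversed from time `a e`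
to time `b e`. -/
noncomputable def progress (le : E → E → Prop) (a b : E → ℝ) (e : E) (r : ℝ) : ℝ :=
  ind (le e e) * max 0 (min 1 ((r - a e) / (b e - a e)))

theorem continuous_progress (le : E → E → Prop) (a b : E → ℝ) (e : E) :
    Continuous (progress le a b e) := by
  unfold progress
  fun_prop

section

variable {le : E → E → Prop} {a b : E → ℝ}

theorem progress_of_not {e : E} {r : ℝ} (he : ¬ le e e) : progress le a b e r = 0 := by
  simp [progress, he]

theorem IsIntervalRep.progress_of_le (hI : IsIntervalRep le a b) {e : E} {r : ℝ} (he : le e e)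
    (h : r ≤ a e) : progress le a b e r = 0 := by
  have := hI.lt he
  have h2 : (r - a e) / (b e - a e) ≤ 0 :=
    div_nonpos_of_nonpos_of_nonneg (by linarith) (by linarith)
  rw [progress, max_eq_left ((min_le_right _ _).trans h2), mul_zero]

theorem IsIntervalRep.progress_of_ge (hI : IsIntervalRep le a b) {e : E} {r : ℝ} (he : le e e)
    (h : b e ≤ r) : progress le a b e r = 1 := by
  have := hI.lt he
  have h2 : 1 ≤ (r - a e) / (b e - a e) := by
    rw [one_le_div (by linarith)]
    linarith
  rw [progress, min_eq_left h2, max_eq_right zero_le_one, ind_of_true he, mul_one]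

theorem IsIntervalRep.progress_of_mem (hI : IsIntervalRep le a b) {e : E} (he : le e e)
    {x : ℝ} (hx : x ∈ Set.Ioo (0 : ℝ) 1) : progress le a b e (a e + x * (b e - a e)) = x := by
  have := hI.lt he
  rw [progress, add_sub_cancel_left, mul_div_assoc, div_self (by linarith), mul_one,
    min_eq_right hx.2.le, max_eq_right hx.1.le, ind_of_true he, one_mul]

theorem IsIntervalRep.mem_Ioo (hI : IsIntervalRep le a b) {e : E} (he : le e e)
    {x : ℝ} (hx : x ∈ Set.Ioo (0 : ℝ) 1) : a e + x * (b e - a e) ∈ Set.Ioo (a e) (b e) := by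
  have := hI.lt he
  constructor <;> nlinarith [hx.1, hx.2]

/-- The intervals of distinct edges are disjoint. -/
theorem IsIntervalRep.eq_of_mem_Ioo (hI : IsIntervalRep le a b) {F : Set E}
    (h : IsOrderWithin F le) {e f : E} (he : le e e) (hf : le f f) {r : ℝ}
    (hre : r ∈ Set.Ioo (a e) (b e)) (hrf : r ∈ Set.Ioo (a f) (b f)) : e = f := by
  by_contra hne
  rcases h.total he hf with hef | hfe
  · linarith [hI.le_of_ne hef hne, hre.2, hrf.1]
  · linarith [hI.le_of_ne hfe (Ne.symm hne), hrf.2, hre.1]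

end

/-- The position at time `r` of a point that runs through the edges in the given order. -/
theorem exists_position (hlf : G.LocallyFinite) (hconn : G.WeaklyConnected)
    {s t : V ⊕ G.Ends} {F : Set E} {le : E → E → Prop} (h : IsOrderWithin F le)
    (htr : ∀ U, G.FiniteBoundary U → G.Tracks s t le U) {a b : E → ℝ}
    (hI : IsIntervalRep le a b) (r : ℝ) :
    ∃ q : G.Point,
      (∀ U, G.FiniteBoundary U → G.level U q = ind (s ∈ G.vertexClosure U) +
        G.inflow U fun e => progress le a b e r) ∧
      (∀ e, G.tent e q = progress le a b e r * (1 - progress le a b e r)) ∧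
      (∀ e x, q = .inner e x ↔ le e e ∧ r = a e + x * (b e - a e)) := by
  by_cases hr : ∃ e, le e e ∧ r ∈ Set.Ioo (a e) (b e)
  · obtain ⟨e, he, hre⟩ := hr
    have hpos : 0 < b e - a e := sub_pos.2 (hI.lt he)
    have hx : (r - a e) / (b e - a e) ∈ Set.Ioo (0 : ℝ) 1 :=
      ⟨div_pos (sub_pos.2 hre.1) hpos, (div_lt_one hpos).2 (by linarith [hre.2])⟩
    obtain ⟨x, hxr⟩ : ∃ x : Set.Ioo (0 : ℝ) 1, r = a e + x * (b e - a e) :=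
      ⟨⟨_, hx⟩, by rw [div_mul_cancel₀ _ hpos.ne']; ring⟩
    have hpe : progress le a b e r = x := by rw [hxr]; exact hI.progress_of_mem he x.2
    -- Inside the interval of `e`, all earlier edges are complete and `e` lacks the fraction `1 -
    -- x`; so the balance up to `e` needs just one correction.
    have hprog : ∀ f, progress le a b f r = ind (le f e) - ind (f = e) * (1 - x) := by
      intro f
      by_cases hfe : f = e
      · subst hfe
        rw [hpe, ind_of_true he, ind_of_true rfl]
        ring
      rw [ind_of_false hfe, zero_mul, sub_zero]
      by_cases hff : le f f
      · by_cases hle : le f e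
        · rw [ind_of_true hle]
          exact hI.progress_of_ge hff ((hI.le_of_ne hle hfe).trans hre.1.le)
        · rw [ind_of_false hle]
          have hef := (h.total hff he).resolve_left hle
          exact hI.progress_of_le hff (hre.2.le.trans (hI.le_of_ne hef (Ne.symm hfe)))
      · rw [progress_of_not hff, ind_of_false fun hle => hff (h.refl_left hle)]
    refine ⟨.inner e x, fun U hU => ?_, fun f => ?_, fun f y => ?_⟩
    · simp only [hprog]
      rw [inflow_sub_single hU, ← add_sub_assoc, (htr U hU).upTo e he, increase, level]
      ring
    · by_cases hfe : f = e
      · subst hfe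
        rw [hpe, tent, ind_of_true rfl, one_mul]
      · rw [tent, ind_of_false (Ne.symm hfe), zero_mul, hprog, ind_of_false hfe, zero_mul,
          sub_zero]
        by_cases hle : le f e <;> simp [hle]
    · constructor
      · intro heq
        obtain ⟨rfl, rfl⟩ := Point.inner.inj heq
        exact ⟨he, hxr⟩
      · rintro ⟨hf, hry⟩
        obtain rfl := hI.eq_of_mem_Ioo h he hf hre (by rw [hry]; exact hI.mem_Ioo hf y.2)
        have : x = y := by
          refine Subtype.ext (mul_right_cancel₀ hpos.ne' ?_)
          linarith
        rw [this]
  · push Not at hr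
    have hr' : ∀ e, le e e → r ≤ a e ∨ b e ≤ r := fun e he => by
      by_contra hc
      push Not at hc
      exact hr e he hc
    -- Outside all intervals, every edge is either complete or not yet begun.
    obtain ⟨p, hp⟩ := exists_point_of_initial hlf hconn h htr (D := {e | le e e ∧ b e ≤ r})
      (fun e he => he.1) (by
        rintro e f hef ⟨hf, hbf⟩
        refine ⟨h.refl_left hef, ?_⟩
        by_cases heq : e = f
        · rwa [heq]
        · linarith [hI.le_of_ne hef heq, hI.lt hf])
    have hprog : ∀ e, progress le a b e r = ind (e ∈ {e | le e e ∧ b e ≤ r}) := by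
      intro e
      by_cases he : le e e
      · by_cases hb : b e ≤ r
        · rw [hI.progress_of_ge he hb, ind_of_true ⟨he, hb⟩]
        · rw [hI.progress_of_le he ((hr' e he).resolve_right hb), ind_of_false fun hc => hb hc.2]
      · rw [progress_of_not he, ind_of_false fun hc => he hc.1]
    refine ⟨G.toPoint p, fun U hU => ?_, fun e => ?_, fun e x => ?_⟩
    · rw [level_toPoint, hp U hU]
      simp only [hprog]
    · have : G.tent e (G.toPoint p) = 0 := by rcases p with v | ω <;> rfl
      rw [this, hprog]
      by_cases he : e ∈ {e | le e e ∧ b e ≤ r}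
      · rw [ind_of_true he]; ring
      · rw [ind_of_false he]; ring
    · constructor
      · intro heq
        rcases p with v | ω <;> cases heq
      · rintro ⟨he, hrx⟩
        exact absurd (by rw [hrx]; exact hI.mem_Ioo he x.2) (hr e he)

theorem LocallyFinite.eq_toPoint_of_level (hlf : G.LocallyFinite) {q : G.Point} {p : V ⊕ G.Ends}
    (hq : ∀ e x, q ≠ .inner e x)
    (h : ∀ U, G.FiniteBoundary U → G.level U q = ind (p ∈ G.vertexClosure U)) :
    q = G.toPoint p := by
  obtain ⟨p', rfl⟩ : ∃ p', q = G.toPoint p' := by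
    rcases q with v | ω | ⟨e, x⟩
    · exact ⟨Sum.inl v, rfl⟩
    · exact ⟨Sum.inr ω, rfl⟩
    · exact absurd rfl (hq e x)
  by_contra hne
  obtain ⟨U, hU, hsep⟩ := hlf.exists_separating (p := p') (q := p) fun h => hne (by rw [h])
  refine hsep (ind_inj.1 ?_)
  rw [← level_toPoint, h U hU]

theorem exists_directed_topWalk (hlf : G.LocallyFinite) (hconn : G.WeaklyConnected)
    {s t : V ⊕ G.Ends} (hst : s ≠ t) {F : Set E} {le : E → E → Prop} (h : IsOrderWithin F le)
    (htr : ∀ U, G.FiniteBoundary U → G.Tracks s t le U) :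
    ∃ W : G.TopWalk, W.IsDirected ∧ W.FromTo (G.toPoint s) (G.toPoint t) ∧
      W.carrier ⊆ G.edgeClosure F := by
  -- With no edges the total balance would put `s` and `t` on the same side of every finite cut.
  have hne : ∃ e, le e e := by
    by_contra hc
    push Not at hc
    obtain ⟨U, hU, hsep⟩ := hlf.exists_separating hst
    refine hsep (ind_inj.1 ?_)
    rw [← (htr U hU).total]
    simp [inflow, hc]
  have := hlf.countable_edges hconn
  obtain ⟨a, b, hI⟩ := h.exists_intervalRep hne
  choose pos hlevel htent hinner using exists_position hlf hconn h htr hI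
  let σ : unitInterval → G.Point := fun r => pos r
  have hcont : Continuous σ := by
    refine hlf.continuous_of_level_of_tent (fun U hU => ?_) fun e => ?_
    · simp only [σ, hlevel _ U hU, hU.inflow_eq_sum]
      refine continuous_const.add (continuous_finsetSum _ fun e _ => ?_)
      exact ((continuous_progress le a b e).comp continuous_subtype_val).mul continuous_const
    · simp only [σ, htent]
      have hc := (continuous_progress le a b e).comp (continuous_subtype_val (p := (· ∈ unitInterval)))
      exact hc.mul (continuous_const.sub hc)
  have htime : ∀ {e} (x : Set.Ioo (0 : ℝ) 1), le e e → a e + x * (b e - a e) ∈ unitInterval :=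
    fun {e} x he => by
      have := hI.mem_Ioo he x.2
      exact ⟨(hI.nonneg he).trans this.1.le, this.2.le.trans (hI.le_one he)⟩
  have huniq : ∀ p ∈ G.innerPoints Set.univ ∩ Set.range σ, ∃! r, σ r = p := by
    rintro _ ⟨⟨e, -, x, rfl⟩, r, hr⟩
    refine ⟨r, hr, fun r' hr' => Subtype.ext ?_⟩
    rw [((hinner r e x).1 hr).2, ((hinner r' e x).1 hr').2]
  let W : G.TopWalk :=
    { carrier := Set.range σ
      lt := fun p q => p ∈ G.innerPoints Set.univ ∩ Set.range σ ∧
        q ∈ G.innerPoints Set.univ ∩ Set.range σ ∧ ∃ a b, σ a = p ∧ σ b = q ∧ a < b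
      exists_witness := ⟨σ, hcont, rfl, huniq, fun _ _ => Iff.rfl⟩ }
  refine ⟨W, ?_, ⟨σ, ⟨hcont, rfl, huniq, fun _ _ => Iff.rfl⟩, ?_, ?_⟩, ?_⟩
  · rintro e ⟨_, ⟨_, rfl, x₀, rfl⟩, r₀, hr₀⟩ p ⟨_, rfl, x, rfl⟩ q ⟨_, rfl, y, rfl⟩
    have he := ((hinner r₀ _ x₀).1 hr₀).1
    have hpos := sub_pos.2 (hI.lt he)
    constructor
    · rintro ⟨-, -, r, r', hr, hr', hlt⟩
      refine ⟨x, y, rfl, rfl, ?_⟩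
      have h1 := ((hinner r _ x).1 hr).2
      have h2 := ((hinner r' _ y).1 hr').2
      have hlt' : (r : ℝ) < r' := hlt
      rw [h1, h2] at hlt'
      exact Subtype.coe_lt_coe.1 (lt_of_mul_lt_mul_right (lt_of_add_lt_add_left hlt') hpos.le)
    · rintro ⟨x', y', hx, hy, hlt⟩
      obtain ⟨-, rfl⟩ := Point.inner.inj hx
      obtain ⟨-, rfl⟩ := Point.inner.inj hy
      have h1 : σ ⟨_, htime x he⟩ = .inner _ x := (hinner _ _ x).2 ⟨he, rfl⟩
      have h2 : σ ⟨_, htime y he⟩ = .inner _ y := (hinner _ _ y).2 ⟨he, rfl⟩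
      refine ⟨⟨⟨_, trivial, x, rfl⟩, _, h1⟩, ⟨⟨_, trivial, y, rfl⟩, _, h2⟩, _, _, h1, h2, ?_⟩
      rw [Subtype.mk_lt_mk]
      have := mul_lt_mul_of_pos_right (show (x : ℝ) < y from hlt) hpos
      linarith
  · refine hlf.eq_toPoint_of_level (fun e x hx => ?_) fun U hU => ?_
    · obtain ⟨he, h0⟩ := (hinner _ e x).1 hx
      have := hI.mem_Ioo he x.2
      rw [← h0] at this
      have h1 : (((0 : unitInterval) : ℝ)) = 0 := rfl
      linarith [this.1, hI.nonneg he]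
    · have h0 : ∀ e, progress le a b e ((0 : unitInterval) : ℝ) = 0 := fun e => by
        by_cases he : le e e
        · exact hI.progress_of_le he (hI.nonneg he)
        · exact progress_of_not he
      simp only [σ, hlevel _ U hU, h0]
      simp [inflow]
  · refine hlf.eq_toPoint_of_level (fun e x hx => ?_) fun U hU => ?_
    · obtain ⟨he, h0⟩ := (hinner _ e x).1 hx
      have := hI.mem_Ioo he x.2
      rw [← h0] at this
      have h1 : (((1 : unitInterval) : ℝ)) = 1 := rfl
      linarith [this.2, hI.le_one he]
    · have h1 : ∀ e, progress le a b e ((1 : unitInterval) : ℝ) = ind (le e e) := fun e => by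
        by_cases he : le e e
        · rw [ind_of_true he]
          exact hI.progress_of_ge he (hI.le_one he)
        · rw [ind_of_false he]
          exact progress_of_not he
      simp only [σ, hlevel _ U hU, h1]
      exact (htr U hU).total
  · rintro _ ⟨r, rfl⟩
    -- Density of the intervals gives times near `r` at which the walk is inside an edge of `F`.
    refine mem_closure_iff.2 fun O hO hr => ?_
    obtain ⟨ε, hε, hball⟩ := Metric.isOpen_iff.1 (hO.preimage hcont) r hr
    obtain ⟨e, y, he, hcy, hyd, hay, hyb⟩ := hI.dense (max 0 (r - ε)) (min 1 (r + ε))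
      (le_max_left _ _)
      (max_lt (lt_min one_pos (by linarith [r.2.1])) (lt_min (by linarith [r.2.2]) (by linarith)))
      (min_le_left _ _)
    rw [max_lt_iff] at hcy
    rw [lt_min_iff] at hyd
    have hpos := sub_pos.2 (hI.lt he)
    have hx : (y - a e) / (b e - a e) ∈ Set.Ioo (0 : ℝ) 1 :=
      ⟨div_pos (sub_pos.2 hay) hpos, (div_lt_one hpos).2 (by linarith)⟩
    refine ⟨σ ⟨y, hcy.1.le, hyd.1.le⟩, hball ?_, e, h.mem he, ⟨_, hx⟩, (hinner _ _ _).2 ⟨he, ?_⟩⟩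
    · rw [Metric.mem_ball, Subtype.dist_eq, Real.dist_eq, abs_sub_lt_iff]
      constructor <;> linarith [hcy.2, hyd.2]
    · rw [div_mul_cancel₀ _ hpos.ne']
      ring

/-! ### Walks cross finite cuts -/

theorem IsFiniteCutFor.compl_eq {s t : V ⊕ G.Ends} {X Y : Set V} (h : G.IsFiniteCutFor s t X Y) :
    X = Yᶜ := h.1.eq_compl

theorem IsFiniteCutFor.finiteBoundary {s t : V ⊕ G.Ends} {X Y : Set V}
    (h : G.IsFiniteCutFor s t X Y) : G.FiniteBoundary Y := by
  refine h.2.1.subset fun e he => ?_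
  rw [h.compl_eq]
  exact Or.symm he

theorem IsFiniteCutFor.left_notMem {s t : V ⊕ G.Ends} {X Y : Set V}
    (h : G.IsFiniteCutFor s t X Y) : s ∉ G.vertexClosure Y := by
  rw [← mem_vertexClosure_compl h.finiteBoundary, ← h.compl_eq]
  exact h.2.2.1

/-- In the total balance for `Y`, each edge from `X` to `Y` counts 1 and each edge back counts -1,
while the indicator rises from 0 at `s` to 1 at `t`. -/
theorem encard_of_tracks {s t : V ⊕ G.Ends} {le : E → E → Prop} {X Y : Set V}
    (hXY : G.IsFiniteCutFor s t X Y) (htr : G.Tracks s t le Y) :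
    ({e | le e e} ∩ G.dirCut X Y).encard = ({e | le e e} ∩ G.dirCut Y X).encard + 1 := by
  classical
  have hY := hXY.finiteBoundary
  have hX := hXY.compl_eq
  have hfin1 : ({e | le e e} ∩ G.dirCut X Y).Finite :=
    hXY.2.1.subset fun e he => Or.inl he.2
  have hfin2 : ({e | le e e} ∩ G.dirCut Y X).Finite :=
    hXY.2.1.subset fun e he => Or.inr he.2
  have h := htr.total
  rw [ind_of_false hXY.left_notMem, ind_of_true hXY.2.2.2, zero_add,
    inflow_eq_sum _ (hfin1.toFinset ∪ hfin2.toFinset), Finset.sum_union] at h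
  · have h1 : ∑ e ∈ hfin1.toFinset, ind (le e e) * G.increase Y e = hfin1.toFinset.card := by
      rw [Finset.card_eq_sum_ones, Nat.cast_sum]
      refine Finset.sum_congr rfl fun e he => ?_
      obtain ⟨h1, h2, h3⟩ := hfin1.mem_toFinset.1 he
      rw [hX] at h2
      rw [increase, ind_of_true (show le e e from h1), ind_of_true h3, ind_of_false h2]
      simp
    have h2 : ∑ e ∈ hfin2.toFinset, ind (le e e) * G.increase Y e = - hfin2.toFinset.card := by
      rw [Finset.card_eq_sum_ones, Nat.cast_sum, ← Finset.sum_neg_distrib]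
      refine Finset.sum_congr rfl fun e he => ?_
      obtain ⟨h1, h2, h3⟩ := hfin2.mem_toFinset.1 he
      rw [hX] at h3
      rw [increase, ind_of_true (show le e e from h1), ind_of_true h2, ind_of_false h3]
      simp
    rw [h1, h2] at h
    have h3 : hfin1.toFinset.card = hfin2.toFinset.card + 1 := by
      have : (hfin1.toFinset.card : ℝ) = hfin2.toFinset.card + 1 := by linarith
      exact_mod_cast this
    rw [hfin1.encard_eq_coe_toFinset_card, hfin2.encard_eq_coe_toFinset_card, h3]
    rfl
  · rw [Finset.disjoint_left]
    intro e he he'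
    have h1 := (hfin1.mem_toFinset.1 he).2.1
    rw [hX] at h1
    exact h1 (hfin2.mem_toFinset.1 he').2.1
  · intro e he hne
    have hle : le e e := by
      by_contra hc
      exact hne (ind_of_false hc)
    rw [Finset.mem_union, hfin1.mem_toFinset, hfin2.mem_toFinset, hX]
    rcases he with he | he
    · exact Or.inr ⟨hle, he⟩
    · exact Or.inl ⟨hle, he⟩

theorem isOpen_innerPoints (F : Set E) : IsOpen (G.innerPoints F) := by
  refine ⟨fun e => ?_, ?_, ?_, ?_⟩
  · by_cases he : e ∈ F
    · convert isOpen_univ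
      exact Set.eq_univ_of_forall fun x => ⟨e, he, x, rfl⟩
    · convert isOpen_empty
      refine Set.eq_empty_of_forall_notMem ?_
      rintro x ⟨f, hf, y, hxy⟩
      exact he ((Point.inner.inj hxy).1 ▸ hf)
  · rintro e ⟨f, _, x, hx⟩
    cases hx
  · rintro e ⟨f, _, x, hx⟩
    cases hx
  · rintro ω ⟨f, _, x, hx⟩
    cases hx

theorem mem_of_inner_mem_edgeClosure {F : Set E} {e : E} {x : Set.Ioo (0 : ℝ) 1}
    (h : Point.inner e x ∈ G.edgeClosure F) : e ∈ F := by
  obtain ⟨_, ⟨f, hf, y, rfl⟩, g, hg, z, hz⟩ := mem_closure_iff.1 h _ (isOpen_innerPoints {e})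
    ⟨e, rfl, x, rfl⟩
  rw [← Set.mem_singleton_iff.1 hf, (Point.inner.inj hz).1]
  exact hg

/-- A continuous real function that runs from `0` to `1` crosses the interval from `1/3` to
`2/3`. -/
theorem exists_crossing {g : unitInterval → ℝ} (hg : Continuous g) (h0 : g 0 = 0) (h1 : g 1 = 1) :
    ∃ a b : unitInterval, a < b ∧ g a = 1 / 3 ∧ g b = 2 / 3 ∧
      ∀ r ∈ Set.Icc a b, g r ∈ Set.Icc (1 / 3 : ℝ) (2 / 3) := by
  have hA : IsCompact {r | g r ≤ 1 / 3} := (isClosed_le hg continuous_const).isCompact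
  -- `a` is the last time with value at most `1/3`, and `b` the first time from `a` on with value at
  -- least `2/3`.
  obtain ⟨a, ha, hamax⟩ := hA.exists_isGreatest ⟨0, by simp [h0]⟩
  have hB : IsCompact ({r | 2 / 3 ≤ g r} ∩ Set.Ici a) :=
    ((isClosed_le continuous_const hg).inter isClosed_Ici).isCompact
  obtain ⟨b, hb, hbmin⟩ := hB.exists_isLeast ⟨1, by simp [h1]; norm_num, unitInterval.le_one'⟩
  have ha' : g a ≤ 1 / 3 := ha
  have hb' : 2 / 3 ≤ g b := hb.1
  have hab : a < b := lt_of_le_of_ne hb.2 (by rintro rfl; linarith)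
  have hlow : ∀ r, a < r → 1 / 3 < g r := fun r hr => by
    by_contra hc
    exact absurd (hamax (show g r ≤ 1 / 3 from not_lt.1 hc)) (not_le.2 hr)
  have hhigh : ∀ r, a ≤ r → r < b → g r < 2 / 3 := fun r har hr => by
    by_contra hc
    exact absurd (hbmin ⟨not_lt.1 hc, har⟩) (not_le.2 hr)
  have hga : g a = 1 / 3 := by
    obtain ⟨r, hr, hgr⟩ := intermediate_value_Icc hab.le hg.continuousOn
      (show (1 / 3 : ℝ) ∈ Set.Icc (g a) (g b) from ⟨ha', by linarith⟩)
    rcases hr.1.eq_or_lt with rfl | hlt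
    · exact hgr
    · linarith [hlow r hlt]
  have hgb : g b = 2 / 3 := by
    obtain ⟨r, hr, hgr⟩ := intermediate_value_Icc hab.le hg.continuousOn
      (show (2 / 3 : ℝ) ∈ Set.Icc (g a) (g b) from ⟨by linarith, hb'⟩)
    rcases hr.2.eq_or_lt with rfl | hlt
    · exact hgr
    · linarith [hhigh r hr.1 hlt]
  refine ⟨a, b, hab, hga, hgb, fun r hr => ⟨?_, ?_⟩⟩
  · rcases hr.1.eq_or_lt with rfl | hlt
    · exact hga.ge
    · exact (hlow r hlt).le
  · rcases hr.2.eq_or_lt with rfl | hlt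
    · exact hgb.le
    · exact (hhigh r hr.1 hlt).le

theorem TopWalk.IsDirected.inter_dirCut_nonempty {s t : V ⊕ G.Ends} {F : Set E} {W : G.TopWalk}
    (hW : W.IsDirected) (hst : W.FromTo (G.toPoint s) (G.toPoint t))
    (hF : W.carrier ⊆ G.edgeClosure F) {X Y : Set V} (hXY : G.IsFiniteCutFor s t X Y) :
    (F ∩ G.dirCut X Y).Nonempty := by
  obtain ⟨σ, hσ, h0, h1⟩ := hst
  by_contra hemp
  rw [Set.not_nonempty_iff_eq_empty] at hemp
  have hY := hXY.finiteBoundary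
  have hX := hXY.compl_eq
  obtain ⟨a, b, hab, ha, hb, hmid⟩ := exists_crossing ((continuous_level hY).comp hσ.continuous)
    (by simp [h0, level_toPoint, hXY.left_notMem]) (by simp [h1, level_toPoint, hXY.2.2.2])
  have hmem : ∀ r, σ r ∈ W.carrier := fun r => hσ.range_eq ▸ Set.mem_range_self r
  -- A level strictly between 0 and 1 occurs only inside cut edges. With none in `F` from `X` to
  -- `Y`, the edge runs from `Y` to `X`, where the level falls along the edge.
  have hback : ∀ r ∈ Set.Icc a b, ∃ e x, σ r = .inner e x ∧ G.level Y (σ r) = 1 - x := by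
    intro r hr
    have hm : G.level Y (σ r) ∈ Set.Icc (1 / 3 : ℝ) (2 / 3) := hmid r hr
    have hind : ∀ P : Prop, ind P ∉ Set.Icc (1 / 3 : ℝ) (2 / 3) := fun P h => by
      by_cases hP : P
      · rw [ind_of_true hP] at h; linarith [h.2]
      · rw [ind_of_false hP] at h; linarith [h.1]
    rcases hp : σ r with v | ω | ⟨e, x⟩
    · rw [hp] at hm
      exact absurd hm (hind _)
    · rw [hp] at hm
      exact absurd hm (hind _)
    · refine ⟨e, x, rfl, ?_⟩
      rw [hp] at hm
      have heF : e ∈ F := mem_of_inner_mem_edgeClosure (hF (hp ▸ hmem r))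
      by_cases ht : G.tail e ∈ Y <;> by_cases hh : G.head e ∈ Y
      · rw [level_inner_of_iff (iff_of_true ht hh)] at hm
        exact absurd hm (hind _)
      · simp [level, ht, hh]
      · have : e ∈ F ∩ G.dirCut X Y := ⟨heF, by rw [hX]; exact ht, hh⟩
        simp [hemp] at this
      · rw [level_inner_of_iff (iff_of_false ht hh)] at hm
        exact absurd hm (hind _)
  obtain ⟨e, x, hax, hlx⟩ := hback a ⟨le_rfl, hab.le⟩
  -- The image is connected and covered by the open, pairwise disjoint sets of inner points, so it
  -- stays in one edge.
  have hsub : σ '' Set.Icc a b ⊆ G.innerPoints {e} := by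
    refine (isPreconnected_Icc.image σ hσ.continuous.continuousOn).subset_left_of_subset_union
      (isOpen_innerPoints {e}) (isOpen_innerPoints {e}ᶜ) ?_ ?_
      ⟨σ a, ⟨a, ⟨le_rfl, hab.le⟩, rfl⟩, e, rfl, x, hax⟩
    · rw [Set.disjoint_left]
      rintro _ ⟨f, hf, y, rfl⟩ ⟨f', hf', y', h⟩
      exact hf' ((Point.inner.inj h).1 ▸ hf)
    · rintro _ ⟨r, hr, rfl⟩
      obtain ⟨f, y, hfy, -⟩ := hback r hr
      by_cases hfe : f = e
      · exact Or.inl ⟨f, hfe, y, hfy⟩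
      · exact Or.inr ⟨f, hfe, y, hfy⟩
  obtain ⟨f, hf, y, hby⟩ := hsub ⟨b, ⟨hab.le, le_rfl⟩, rfl⟩
  obtain rfl : f = e := hf
  obtain ⟨f', y', hby', hly⟩ := hback b ⟨hab.le, le_rfl⟩
  obtain ⟨rfl, rfl⟩ := Point.inner.inj (hby.symm.trans hby')
  have hlt : W.lt (σ a) (σ b) := (hσ.lt_iff _ _).2
    ⟨⟨⟨f, trivial, x, hax⟩, hmem a⟩, ⟨⟨f, trivial, y, hby⟩, hmem b⟩, a, b, rfl, rfl, hab⟩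
  obtain ⟨x', y', hx', hy', hlt'⟩ := (hW f ⟨σ a, ⟨f, rfl, x, hax⟩, hmem a⟩ (σ a) ⟨f, rfl, x, hax⟩
    (σ b) ⟨f, rfl, y, hby⟩).1 hlt
  obtain ⟨-, rfl⟩ := Point.inner.inj (hax.symm.trans hx')
  obtain ⟨-, rfl⟩ := Point.inner.inj (hby.symm.trans hy')
  -- Directedness forces `x < y`, while the levels `1 - x = 1/3` and `1 - y = 2/3` say the opposite.
  have hlt'' : (x : ℝ) < y := hlt'
  simp only [Function.comp_apply] at ha hb
  linarith

end MultiDigraph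

/-! ### The equivalence -/

theorem lemma3p1 {V E : Type*} (G : MultiDigraph V E) (hlf : G.LocallyFinite)
    (hconn : G.WeaklyConnected) (s t : V ⊕ G.Ends) (hst : s ≠ t) (F : Set E) :
    List.TFAE [
      ∃ W : G.TopWalk, W.IsDirected ∧ W.FromTo (G.toPoint s) (G.toPoint t) ∧
        W.carrier ⊆ G.edgeClosure F,
      ∀ X Y : Set V, G.IsFiniteCutFor s t X Y → 1 ≤ (F ∩ G.dirCut X Y).encard,
      ∃ W ⊆ F, ∀ X Y : Set V, G.IsFiniteCutFor s t X Y →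
        (W ∩ G.dirCut X Y).encard = (W ∩ G.dirCut Y X).encard + 1] := by
  simp only [Set.one_le_encard_iff_nonempty]
  tfae_have 1 → 2 := by
    rintro ⟨W, hW, hfrom, hF⟩ X Y hXY
    exact hW.inter_dirCut_nonempty hfrom hF hXY
  tfae_have 2 → 1 := by
    intro h
    obtain ⟨le, hle, htr⟩ := MultiDigraph.exists_order h
    exact MultiDigraph.exists_directed_topWalk hlf hconn hst hle htr
  tfae_have 2 → 3 := by
    intro h
    obtain ⟨le, hle, htr⟩ := MultiDigraph.exists_order h
    exact ⟨{e | le e e}, fun e he => hle.mem he, fun X Y hXY =>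
      MultiDigraph.encard_of_tracks hXY (htr Y hXY.finiteBoundary)⟩
  tfae_have 3 → 2 := by
    rintro ⟨W, hWF, hW⟩ X Y hXY
    have h1 : (W ∩ G.dirCut X Y).Nonempty := by
      rw [← Set.one_le_encard_iff_nonempty, hW X Y hXY]
      exact le_add_self
    exact h1.mono (Set.inter_subset_inter_left _ hWF)
  tfae_finish
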